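/- **Setting.** An instance of a biobjective combinatorial optimization (BOCO) problem is a pair $(S,C)$ with $S\subseteq\{0,1\}^n$ and $C\in\mathbb{Q}^{2\times n}$; a BOCO problem $P$ is a set of instances, represented by binary words of length $O(n+\langle C\rangle)$, and the input size is $|x| := n+\langle C\rangle$, where $\langle\cdot\rangle$ is the binary encoding length. The *nondominated extreme points* of an instance are the extreme points of its upper image $\{Cx \mid x\in\operatorname{conv} S\}+\mathbb{R}^2_{\ge 0}$. The *lexicographic version* of $P$ asks, for an instance and a weight $\ell\in\mathbb{Q}^2$, $\ell\ge 0$, for the point $Cx$ of a solution $x\in S$ that attains $\operatorname{lexmin}\{(\ell^{T}Cx,\,c_1x,\,c_2x)\mid x\in S\}$ ($c_1,c_2$ the rows of $C$), or for the report that $S=\emptyset$. The *Dichotomic Approach (DA) with access to an algorithm for the lexicographic version* works as follows. It solves the lexicographic version for $\ell=(1,0)$ and $\ell=(0,1)$, with results $y^0$ and $y^1$. If there is no solution, it stops without output; if $y^0=y^1$, it outputs this point and stops; otherwise it outputs both points and puts the pair $(y^0,y^1)$ into a queue. As long as the queue is not empty, it retrieves a pair $(y^2,y^3)$, computes $\lambda=(|y^2_2-y^3_2|,\,|y^2_1-y^3_1|)$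 (up to a positive factor that clears denominators) and the optimal point $\bar y$ of the lexicographic version for $\lambda$. If $\lambda^{T}\bar y=\lambda^{T}y^2$, it discards $\bar y$; otherwise it outputs $\bar y$ and adds the pairs $(\bar y,y^2)$ and $(\bar y,y^3)$ to the queue. The model of computation is a random access machine whose cells hold integers; a call of a subroutine is charged with its running time. "Polynomial time" for the lexicographic version means that the number of steps and the encoding lengths of the numbers in the cells are bounded by a polynomial in $|x|+\langle\ell\rangle$. The $0$-th delay of a run with $k$ outputs is the time before the first output, the $i$-th delay ($1\le i\le k-1$) is the time between the $i$-th and the $(i+1)$-th output, and the $k$-th delay is the time between the last output and termination (for $k=0$, the $0$-th delay is the whole running time). **Corollary.** Let $P$ be a BOCO problem. 1. For every instance of $P$ and every oracle for its lexicographic version, the DA terminates, and it outputs every nondominated extreme point of the instance exactly once and nothing else. 2. If an algorithm $A$ solves the lexicographic version of $P$ in polynomial time, then the DA with $A$ as subroutine enumerates the nondominated extreme points of every instance $x$ of $P$ (each exactly once and nothing else) with incremental delay: there is a polynomial $q$, depending only on $P$ and $A$, such that for every instance $x$ with $k$ nondominated extreme points and every $0\le i\le k$ the $i$-th delay is at most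 $q(|x|+i)$. Throughout the run all memory cells, including those of the subroutine, hold only integers of encoding length at most $q(|x|)$. -/

import Mathlib

/-! ## Encoding lengths -/

/-- Encoding length of an integer: one bit for the sign and `⌈log₂ (|z| + 1)⌉` bits for `|z|`
(in particular `1` for `z = 0`). -/
def encInt (z : ℤ) : ℕ := 1 + Nat.clog 2 (z.natAbs + 1)

/-- Encoding length of a rational number in lowest terms with positive denominator. -/
def encRat (q : ℚ) : ℕ := encInt q.num + encInt q.den

/-- Encoding length of a rational vector. -/
def encVec {n : ℕ} (v : Fin n → ℚ) : ℕ := n + ∑ i, encRat (v i)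

/-- Encoding length of a rational matrix. -/
def encMat {m n : ℕ} (M : Matrix (Fin m) (Fin n) ℚ) : ℕ := m * n + ∑ i, encVec (M i)

/-! ## Biobjective combinatorial optimization -/

/-- An instance `(S, C)`: the solutions `S ⊆ {0,1}ⁿ` and the objective matrix `C ∈ ℚ^{2×n}`. -/
structure BOCOInstance where
  n : ℕ
  S : Set (Fin n → Bool)
  C : Matrix (Fin 2) (Fin n) ℚ

namespace BOCOInstance

/-- The input size `n + ⟨C⟩`. -/
def size (X : BOCOInstance) : ℕ := X.n + encMat X.C

/-- The point `C x` of a 0-1 vector `x`. -/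
def point (X : BOCOInstance) (x : Fin X.n → Bool) : Fin 2 → ℚ :=
  X.C.mulVec (fun j => if x j then 1 else 0)

/-- The solution set as a subset of `ℝⁿ`. -/
def realSolutions (X : BOCOInstance) : Set (Fin X.n → ℝ) :=
  {v | ∃ x ∈ X.S, v = fun j => if x j then 1 else 0}

/-- The upper image `{C x | x ∈ conv S} + ℝ²_≥` of the convex relaxation. -/
def upperImage (X : BOCOInstance) : Set (Fin 2 → ℝ) :=
  {z | ∃ v ∈ convexHull ℝ X.realSolutions, ∃ r : Fin 2 → ℝ, 0 ≤ r ∧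
    z = (X.C.map (fun q : ℚ => (q : ℝ))).mulVec v + r}

/-- The nondominated extreme points: the extreme points of the upper image. -/
def nondominatedExtremePoints (X : BOCOInstance) : Set (Fin 2 → ℝ) :=
  Set.extremePoints ℝ X.upperImage

/-- `x` solves the lexicographic weighted-sum problem
`lexmin {(ℓᵀ C x, c₁ x, c₂ x) | x ∈ S}`. -/
def IsLexMin (X : BOCOInstance) (l : Fin 2 → ℚ) (x : Fin X.n → Bool) : Prop :=
  x ∈ X.S ∧ ∀ x' ∈ X.S,
    toLex ![l ⬝ᵥ X.point x, X.point x 0, X.point x 1] ≤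
      toLex ![l ⬝ᵥ X.point x', X.point x' 0, X.point x' 1]

end BOCOInstance

/-- A BOCO problem: a language `I` of binary words, each of which represents an instance, with
words of length `O(n + ⟨C⟩)`. -/
structure BOCOProblem where
  I : Set (List Bool)
  inst : List Bool → BOCOInstance
  length_le : ∃ k : ℕ, ∀ w ∈ I, w.length ≤ k * ((inst w).size + 1)

/-- The representation of a vector of `ℚ²` by integers: numerator and denominator, in lowest terms
with positive denominator, of the two components. -/
def encPoint (y : Fin 2 → ℚ) : List ℤ := [(y 0).num, (y 0).den, (y 1).num, (y 1).den]

/-- `ans` is a correct answer to the lexicographic weighted-sum problem with weights `l`: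
the optimal point, or the empty list if the instance is infeasible. -/
def IsLexAnswer (X : BOCOInstance) (l : Fin 2 → ℚ) (ans : List ℤ) : Prop :=
  (X.S = ∅ ∧ ans = []) ∨ ∃ x, X.IsLexMin l x ∧ ans = encPoint (X.point x)

/-! ## Random access machines

The memory is a sequence of cells `mem 0, mem 1, …` that hold integers of bounded encoding length.
The input word is read-only, the output is write-only and consists of records (one record for every
object that is output), and a subroutine (or oracle) can be called. -/

inductive Instr where
  /-- `mem d := z` -/
  | const (d : ℕ) (z : ℤ)
  /-- `mem d := mem a` -/
  | copy (d a : ℕ)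
  /-- `mem d := mem a + mem b` -/
  | add (d a b : ℕ)
  /-- `mem d := mem a - mem b` -/
  | sub (d a b : ℕ)
  /-- `mem d := mem a * mem b` -/
  | mul (d a b : ℕ)
  /-- `mem d := mem a / mem b` (integer quotient; `0` if `mem b = 0`) -/
  | div (d a b : ℕ)
  /-- `mem d := mem a % mem b` (remainder; `mem a` if `mem b = 0`) -/
  | mod (d a b : ℕ)
  /-- indirect addressing: `mem d := mem (mem a + k)` -/
  | load (d a k : ℕ)
  /-- indirect addressing: `mem (mem a + k) := mem s` -/
  | store (a k s : ℕ)
  /-- `mem d :=` the bit of the input word at position `mem a`, or `-1` if there is none -/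
  | read (d a : ℕ)
  /-- continue at instruction `t` -/
  | jump (t : ℕ)
  /-- continue at instruction `t` if `mem a = 0` -/
  | jumpZero (a t : ℕ)
  /-- continue at instruction `t` if `mem a < 0` -/
  | jumpNeg (a t : ℕ)
  /-- output the record of the contents of the listed cells -/
  | emit (as : List ℕ)
  /-- call the subroutine on the contents of the listed cells; the length of its answer is
  written to cell `d`, the answer itself to the cells `d + 1, d + 2, …` -/
  | call (as : List ℕ) (d : ℕ)
  /-- stop -/
  | halt

/-- What a subroutine does on a list of arguments: its answer and its running time, or `none` if it
does not return. -/
abbrev Subroutine := List ℤ → Option (List ℤ × ℕ)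

/-- A program together with everything its run depends on. `wordSize` bounds the encoding length of
the integers that a memory cell can hold (`⊤`: no bound). -/
structure Machine where
  prog : List Instr
  wordSize : ℕ∞
  input : List Bool
  sub : Subroutine

/-- A configuration: program counter, memory, records output so far (in order, each with the time
of its output), and time elapsed so far. -/
structure Config where
  pc : ℕ
  mem : ℕ → ℤ
  out : List (ℕ × List ℤ)
  time : ℕ

/-- Initial configuration: the arguments are in the first cells, all other cells hold `0`. -/
def Config.init (args : List ℤ) : Config :=
  { pc := 0, mem := fun a => args.getD a 0, out := [], time := 0 }

/-- Write `z` to cell `d` and go on to the next instruction; impossible if `z` is too long. -/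
def Config.write (c : Config) (W : ℕ∞) (d : ℕ) (z : ℤ) : Option Config :=
  if (encInt z : ℕ∞) ≤ W then
    some { c with pc := c.pc + 1, mem := Function.update c.mem d z, time := c.time + 1 }
  else none

/-- Continue at instruction `t`. -/
def Config.goto (c : Config) (t : ℕ) : Config := { c with pc := t, time := c.time + 1 }

/-- The memory after the answer `ans` of a subroutine has been written to the cells from `d` on. -/
def receive (mem : ℕ → ℤ) (d : ℕ) (ans : List ℤ) : ℕ → ℤ := fun a =>
  if a = d then (ans.length : ℤ)
  else if d < a ∧ a ≤ d + ans.length then ans.getD (a - d - 1) 0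
  else mem a

/-- One step. Every instruction takes one unit of time; in addition, an output takes one unit for
every number, and a call takes the running time of the subroutine and one unit for every number
that is handed over. There is no next configuration after `halt`, nor after an error (a number that
does not fit into a cell, a negative address, a program counter outside of the program, a
subroutine that does not return). -/
def Machine.step (M : Machine) (c : Config) : Option Config :=
  match M.prog[c.pc]? with
  | none => none
  | some (.const d z) => c.write M.wordSize d z
  | some (.copy d a) => c.write M.wordSize d (c.mem a)
  | some (.add d a b) => c.write M.wordSize d (c.mem a + c.mem b)
  | some (.sub d a b) => c.write M.wordSize d (c.mem a - c.mem b)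
  | some (.mul d a b) => c.write M.wordSize d (c.mem a * c.mem b)
  | some (.div d a b) => c.write M.wordSize d (c.mem a / c.mem b)
  | some (.mod d a b) => c.write M.wordSize d (c.mem a % c.mem b)
  | some (.load d a k) =>
      if 0 ≤ c.mem a then c.write M.wordSize d (c.mem ((c.mem a).toNat + k)) else none
  | some (.store a k s) =>
      if 0 ≤ c.mem a then c.write M.wordSize ((c.mem a).toNat + k) (c.mem s) else none
  | some (.read d a) =>
      if 0 ≤ c.mem a then
        c.write M.wordSize d
          (match M.input[(c.mem a).toNat]? with
            | none => -1
            | some false => 0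
            | some true => 1)
      else none
  | some (.jump t) => some (c.goto t)
  | some (.jumpZero a t) => some (c.goto (if c.mem a = 0 then t else c.pc + 1))
  | some (.jumpNeg a t) => some (c.goto (if c.mem a < 0 then t else c.pc + 1))
  | some (.emit as) =>
      some { c with
        pc := c.pc + 1
        out := c.out ++ [(c.time + 1 + as.length, as.map c.mem)]
        time := c.time + 1 + as.length }
  | some (.call as d) =>
      match M.sub (as.map c.mem) with
      | none => none
      | some (ans, t) =>
          if (encInt ans.length : ℕ∞) ≤ M.wordSize ∧
              ∀ z ∈ ans, (encInt z : ℕ∞) ≤ M.wordSize then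
            some { c with
              pc := c.pc + 1
              mem := receive c.mem d ans
              time := c.time + 1 + as.length + t + ans.length }
          else none
  | some .halt => none

/-- Started with the arguments `args`, the machine halts in the configuration `c`. -/
def Machine.HaltsIn (M : Machine) (args : List ℤ) (c : Config) : Prop :=
  Relation.ReflTransGen (fun a b => M.step a = some b) (Config.init args) c ∧
    M.prog[c.pc]? = some Instr.halt

/-- All numbers that have been output. -/
def Config.answer (c : Config) : List ℤ := (c.out.map Prod.snd).flatten

/-- The machine that runs `A` on the input `w`, without any subroutine. -/
def plainMachine (A : List Instr) (W : ℕ∞) (w : List Bool) : Machine :=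
  { prog := A, wordSize := W, input := w, sub := fun _ => none }

open Classical in
/-- The program `A` as a subroutine of a machine with word size `W` and input `w`: `A` is run on a
memory of its own, with the same word size and with access to the same input word. -/
noncomputable def programSubroutine (A : List Instr) (W : ℕ∞) (w : List Bool) : Subroutine :=
  fun args =>
    if h : ∃ c, (plainMachine A W w).HaltsIn args c then some (h.choose.answer, h.choose.time)
    else none

/-- `A` solves the lexicographic version of `P` in polynomial time: given an instance and rational
weights `l ≥ 0`, it computes the lexicographic optimum, where the number of steps and the encoding
lengths of the numbers in the memory are bounded by a polynomial in the size of the instance and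
of the weights. -/
def SolvesLexInPolyTime (P : BOCOProblem) (A : List Instr) : Prop :=
  ∃ p : Polynomial ℕ, ∀ w ∈ P.I, ∀ l : Fin 2 → ℚ, 0 ≤ l → ∃ c : Config,
    (plainMachine A (p.eval ((P.inst w).size + encVec l) : ℕ) w).HaltsIn (encPoint l) c ∧
    c.time ≤ p.eval ((P.inst w).size + encVec l) ∧
    IsLexAnswer (P.inst w) l c.answer

/-- The subroutine `sub` is an oracle for the lexicographic version of the instance `X`. -/
def IsLexOracle (X : BOCOInstance) (sub : Subroutine) : Prop :=
  ∀ l : Fin 2 → ℚ, 0 ≤ l → ∃ ans t, sub (encPoint l) = some (ans, t) ∧ IsLexAnswer X l ans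

/-! ## Enumeration -/

/-- The records output up to the configuration `c` are the nondominated extreme points of `X`, each
of them exactly once. -/
def EnumeratesExtremePoints (X : BOCOInstance) (c : Config) : Prop :=
  ∃ ys : List (Fin 2 → ℚ), c.out.map Prod.snd = ys.map encPoint ∧ ys.Nodup ∧
    {z : Fin 2 → ℝ | ∃ y ∈ ys, z = fun i => (y i : ℝ)} = X.nondominatedExtremePoints

/-- The `i`-th delay of a run that halts in `c` after `k` outputs, `0 ≤ i ≤ k`: the time from the
`i`-th output (from the start, if `i = 0`) to the next one (to the end of the run, if `i = k`). -/
def Config.delay (c : Config) (i : ℕ) : ℕ :=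
  (c.out.map Prod.fst ++ [c.time]).getD i 0 - (0 :: c.out.map Prod.fst).getD i 0

/-! ## The Dichotomic Approach with a lexicographic oracle

Points are stored in four consecutive cells, as numerator and denominator of the first and of the
second component.

* cells 0-3: the weights `λ`; cell 4: length of the answer; cells 5-8: the answer `ȳ`
* cells 10-13: the point `y²`; cells 14-17: the point `y³`
* cells 20-29: auxiliary
* cells 30, 31: first cell of the queue, first cell behind the queue
* cells 32, 33: the constants 8, 16
* cells from 40 on: the queue, with eight cells for each pair of points

The points `y⁰`, `y¹` of the initial step are kept in cells 10-13 and 5-8. The weights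
`(|y²₂ - y³₂|, |y²₁ - y³₁|)` are multiplied by the product of the four denominators, so that they
are integers; this changes neither the lexicographic optimum nor the comparison of the values
`λᵀ y`. -/
def dichotomicApproach : List Instr := [
  -- 0: lexicographic optimum for the weights (1, 0)
  .const 0 1, .const 1 1, .const 2 0, .const 3 1,
  .call [0, 1, 2, 3] 4,
  -- 5: stop if there is no solution; otherwise output the optimum
  .jumpZero 4 104,
  .emit [5, 6, 7, 8],
  .copy 10 5, .copy 11 6, .copy 12 7, .copy 13 8,
  -- 11: lexicographic optimum for the weights (0, 1)
  .const 0 0, .const 2 1,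
  .call [0, 1, 2, 3] 4,
  -- 14: stop if the two points agree in all four cells
  .sub 20 5 10, .sub 21 6 11, .sub 22 7 12, .sub 23 8 13,
  .mul 20 20 20, .mul 21 21 21, .mul 22 22 22, .mul 23 23 23,
  .add 20 20 21, .add 20 20 22, .add 20 20 23,
  .jumpZero 20 104,
  -- 26: output the second point; the queue consists of the pair of the two points
  .emit [5, 6, 7, 8],
  .copy 40 10, .copy 41 11, .copy 42 12, .copy 43 13,
  .copy 44 5, .copy 45 6, .copy 46 7, .copy 47 8,
  .const 30 40, .const 31 48, .const 32 8, .const 33 16,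
  -- 39: main loop; stop if the queue is empty
  .sub 20 31 30,
  .jumpZero 20 104,
  -- 41: retrieve the pair (y², y³) from the front of the queue
  .load 10 30 0, .load 11 30 1, .load 12 30 2, .load 13 30 3,
  .load 14 30 4, .load 15 30 5, .load 16 30 6, .load 17 30 7,
  .add 30 30 32,
  -- 50: 22 and 23 := products of the denominators of the first and of the second components
  .mul 22 11 15, .mul 23 13 17,
  -- 52: first weight
  .mul 20 12 17, .mul 21 16 13, .sub 0 20 21, .mul 0 0 22,
  .jumpNeg 0 58,
  .jump 60,
  .const 20 0, .sub 0 20 0,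
  -- 60: second weight
  .mul 20 10 15, .mul 21 14 11, .sub 2 20 21, .mul 2 2 23,
  .jumpNeg 2 66,
  .jump 68,
  .const 20 0, .sub 2 20 2,
  -- 68: lexicographic optimum for these weights
  .call [0, 1, 2, 3] 4,
  -- 69: values of λᵀ ȳ and λᵀ y², multiplied by the four denominators of ȳ and y²; next pair if
  -- they are equal
  .mul 20 0 5, .mul 20 20 8, .mul 21 2 7, .mul 21 21 6, .add 20 20 21,
  .mul 20 20 11, .mul 20 20 13,
  .mul 22 0 10, .mul 22 22 13, .mul 23 2 12, .mul 23 23 11, .add 22 22 23,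
  .mul 22 22 6, .mul 22 22 8,
  .sub 20 20 22,
  .jumpZero 20 39,
  -- 85: otherwise output ȳ and append the pairs (ȳ, y²) and (ȳ, y³) to the queue
  .emit [5, 6, 7, 8],
  .store 31 0 5, .store 31 1 6, .store 31 2 7, .store 31 3 8,
  .store 31 4 10, .store 31 5 11, .store 31 6 12, .store 31 7 13,
  .store 31 8 5, .store 31 9 6, .store 31 10 7, .store 31 11 8,
  .store 31 12 14, .store 31 13 15, .store 31 14 16, .store 31 15 17,
  .add 31 31 33,
  .jump 39,
  -- 104
  .halt]

/-! The upper image is the convex hull of the points `C x` plus the nonnegative quadrant. Hence its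
extreme points are among the points `C x`, so they are rational, and no extreme point is weakly
dominated by a proper convex combination of points unless these coincide with it
(`eq_of_mem_extremePts`). Ordered by the first component, the extreme points have strictly
decreasing second components.

Correctness rests on two facts. A lexicographic optimum for any weights `l ≥ 0`, even with a zero
component, is an extreme point (`IsLexMin.mem_extremePts`): the upper image lies in the
lexicographic half-plane above the optimum, and the optimum is extreme already there. An extreme
point strictly between two points is strictly better than the worse of them whenever the second
weight is positive (`not_le_of_mem_extremePts`). For a pair `u`, `v` of equal value this gives a
dichotomy. If the optimum does not improve on `u`, no extreme point lies between, and the pair can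
be dropped. Otherwise the optimum is an extreme point strictly between, which splits the pair into
two. So every extreme point is, at any time, either output once or strictly between the points of
exactly one waiting pair (`SearchInv`); an empty queue means that all have been output once.

The delay is a counting argument. An iteration with output lengthens the queue by one, an iteration
without output shortens it by one, and initially there are two outputs and one pair. So there are
always fewer pairs than outputs, and after `i` outputs fewer than `i` iterations can pass without a
further one. With time `T` for the subroutine, an iteration costs less than `T + 100`, whence the
bound `(T + 100) * (i + 1)`.

For the cell lengths, numerators and denominators of all points are at most `2 ^ X.size`, and each
computed number is a product of boundedly many of them up to a constant factor. Addresses are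
bounded because there are at most `2 ^ X.n` outputs. The rest is symbolic execution of the program.
-/

/-! ## The upper image -/

/-- A rational point of the plane as a real point. -/
def realPoint (y : Fin 2 → ℚ) : Fin 2 → ℝ := fun i => (y i : ℝ)

theorem realPoint_injective : Function.Injective realPoint := by
  intro y z h
  funext i
  exact Rat.cast_injective (congrFun h i)

namespace BOCOInstance

/-- The points `C x` of the solutions. -/
def points (X : BOCOInstance) : Set (Fin 2 → ℚ) := X.point '' X.S

/-- The nondominated extreme points, as rational points. -/
def extremePts (X : BOCOInstance) : Set (Fin 2 → ℚ) :=
  {y | realPoint y ∈ X.nondominatedExtremePoints}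

variable {X : BOCOInstance}

theorem realPoint_point (X : BOCOInstance) (x : Fin X.n → Bool) :
    realPoint (X.point x) = (X.C.map (fun q : ℚ => (q : ℝ))).mulVec
      (fun j => if x j then 1 else 0) := by
  funext i
  simp only [realPoint, point, Matrix.mulVec, dotProduct, Matrix.map_apply, Rat.cast_sum,
    Rat.cast_mul]
  refine Finset.sum_congr rfl fun j _ => ?_
  split_ifs <;> simp

/-- A linear map commutes with the convex hull, so from here on everything happens in the plane. -/
theorem upperImage_eq (X : BOCOInstance) :
    X.upperImage = {z | ∃ y ∈ convexHull ℝ (realPoint '' X.points), ∃ r : Fin 2 → ℝ, 0 ≤ r ∧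
      z = y + r} := by
  have h : convexHull ℝ (realPoint '' X.points) =
      (X.C.map (fun q : ℚ => (q : ℝ))).mulVecLin '' convexHull ℝ X.realSolutions := by
    rw [LinearMap.image_convexHull]
    congr 1
    ext z
    simp only [points, realSolutions, Set.mem_image, Set.mem_ofPred_eq]
    constructor
    · rintro ⟨_, ⟨x, hx, rfl⟩, rfl⟩
      exact ⟨_, ⟨x, hx, rfl⟩, (X.realPoint_point x).symm⟩
    · rintro ⟨_, ⟨x, hx, rfl⟩, rfl⟩
      exact ⟨_, ⟨x, hx, rfl⟩, X.realPoint_point x⟩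
  ext z
  simp only [upperImage, h, Set.mem_image, Set.mem_ofPred_eq]
  constructor
  · rintro ⟨v, hv, r, hr, rfl⟩
    exact ⟨_, ⟨v, hv, rfl⟩, r, hr, rfl⟩
  · rintro ⟨_, ⟨v, hv, rfl⟩, r, hr, rfl⟩
    exact ⟨v, hv, r, hr, rfl⟩

theorem add_mem_upperImage {y : Fin 2 → ℚ} (hy : y ∈ X.points) {r : Fin 2 → ℝ} (hr : 0 ≤ r) :
    realPoint y + r ∈ X.upperImage := by
  rw [upperImage_eq]
  exact ⟨_, subset_convexHull ℝ _ ⟨y, hy, rfl⟩, r, hr, rfl⟩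

/-- An extreme point `y + r` is the midpoint of `y` and `y + 2r`, both in the upper image, so `r`
vanishes. Then `y` is extreme in the smaller set `conv`, and extreme points of a convex hull belong
to the generating set. -/
theorem exists_point_of_mem_nondominatedExtremePoints {z : Fin 2 → ℝ}
    (hz : z ∈ X.nondominatedExtremePoints) : ∃ y ∈ X.points, realPoint y = z := by
  have hz' := hz
  rw [nondominatedExtremePoints, upperImage_eq] at hz
  obtain ⟨⟨y, hy, r, hr, rfl⟩, hext⟩ := hz
  have hyr : y = y + r := by
    refine hext ⟨y, hy, 0, le_rfl, by simp⟩ ⟨y, hy, (2 : ℝ) • r, smul_nonneg zero_le_two hr, rfl⟩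
      ⟨1 / 2, 1 / 2, by norm_num, by norm_num, by norm_num, ?_⟩
    funext i
    simp only [Pi.add_apply, Pi.smul_apply, smul_eq_mul]
    ring
  rw [← hyr] at hz' ⊢
  have hsub : convexHull ℝ (realPoint '' X.points) ⊆ X.upperImage := by
    intro v hv
    rw [upperImage_eq]
    exact ⟨v, hv, 0, le_rfl, by simp⟩
  have hmem : y ∈ realPoint '' X.points := extremePoints_convexHull_subset
    (inter_extremePoints_subset_extremePoints_of_subset hsub ⟨hy, hz'⟩)
  exact hmem

theorem extremePts_subset_points : X.extremePts ⊆ X.points := by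
  intro y hy
  obtain ⟨y', hy', h⟩ := exists_point_of_mem_nondominatedExtremePoints hy
  rwa [← realPoint_injective h]

theorem realPoint_image_extremePts : realPoint '' X.extremePts = X.nondominatedExtremePoints := by
  ext z
  constructor
  · rintro ⟨y, hy, rfl⟩
    exact hy
  · intro hz
    obtain ⟨y, -, rfl⟩ := exists_point_of_mem_nondominatedExtremePoints hz
    exact ⟨y, hz, rfl⟩

/-! ### Domination and the order of the extreme points -/

/-- An extreme point is not dominated by a proper convex combination of two points. -/
theorem eq_of_mem_extremePts {e u v r : Fin 2 → ℚ} (he : e ∈ X.extremePts) (hu : u ∈ X.points)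
    (hv : v ∈ X.points) {a b : ℚ} (ha : 0 < a) (hb : 0 < b) (hab : a + b = 1) (hr : 0 ≤ r)
    (h : e = a • u + b • v + r) : u = e := by
  -- The surplus is absorbed by the second point: `a • u + b • v + r = a • u + b • (v + b⁻¹ • r)` is
  -- a proper convex combination of two points of the upper image.
  have h0 : (0 : Fin 2 → ℝ) ≤ (b : ℝ)⁻¹ • realPoint r := by
    refine smul_nonneg (by positivity) fun i => ?_
    exact Rat.cast_nonneg.2 (hr i)
  have hu' : realPoint u ∈ X.upperImage := by
    simpa using add_mem_upperImage hu (le_refl (0 : Fin 2 → ℝ))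
  refine realPoint_injective (he.2 hu' (add_mem_upperImage hv h0)
    ⟨a, b, by exact_mod_cast ha, by exact_mod_cast hb, by exact_mod_cast hab, ?_⟩)
  have hb' : (b : ℝ) ≠ 0 := by exact_mod_cast hb.ne'
  funext i
  simp only [h, realPoint, Pi.add_apply, Pi.smul_apply, smul_eq_mul, Rat.cast_add, Rat.cast_mul]
  field_simp
  ring

theorem eq_of_le_of_mem_extremePts {e y : Fin 2 → ℚ} (he : e ∈ X.extremePts) (hy : y ∈ X.points)
    (h0 : y 0 ≤ e 0) (h1 : y 1 ≤ e 1) : y = e := by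
  refine eq_of_mem_extremePts (r := e - y) (a := 1 / 2) (b := 1 / 2) he hy hy (by norm_num)
    (by norm_num) (by norm_num) ?_ ?_
  · intro i
    fin_cases i <;> simpa
  · funext i
    simp only [Pi.add_apply, Pi.smul_apply, Pi.sub_apply, smul_eq_mul]
    ring

/-- Two extreme points with the same first component are equal. -/
theorem extremePts_eq_of_fst_eq {e f : Fin 2 → ℚ} (he : e ∈ X.extremePts) (hf : f ∈ X.extremePts)
    (h : e 0 = f 0) : e = f := by
  rcases le_total (e 1) (f 1) with h1 | h1
  · exact eq_of_le_of_mem_extremePts hf (extremePts_subset_points he) h.le h1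
  · exact (eq_of_le_of_mem_extremePts he (extremePts_subset_points hf) h.ge h1).symm

theorem extremePts_snd_lt {e f : Fin 2 → ℚ} (he : e ∈ X.extremePts) (hf : f ∈ X.extremePts)
    (h : e 0 < f 0) : f 1 < e 1 := by
  by_contra! h1
  have := eq_of_le_of_mem_extremePts hf (extremePts_subset_points he) h.le h1
  exact h.ne (by rw [this])

/-- An extreme point between two points is strictly better than the worse of the two, with respect
to any weights of which the second is positive. -/
theorem not_le_of_mem_extremePts {e p q l : Fin 2 → ℚ} (he : e ∈ X.extremePts)
    (hp : p ∈ X.points) (hq : q ∈ X.points) (hpe : p 0 < e 0) (heq : e 0 < q 0) (hl : 0 < l 1)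
    (hlp : l ⬝ᵥ p ≤ l ⬝ᵥ e) (hlq : l ⬝ᵥ q ≤ l ⬝ᵥ e) : False := by
  have hpq : 0 < q 0 - p 0 := by linarith
  -- These coefficients give `a • p + b • q` the first component of `e`. Its value is at most that
  -- of `e`, so by `0 < l 1` its second component is not larger either, and it dominates `e`.
  set a := (q 0 - e 0) / (q 0 - p 0) with ha_def
  set b := (e 0 - p 0) / (q 0 - p 0) with hb_def
  have ha : 0 < a := div_pos (by linarith) hpq
  have hb : 0 < b := div_pos (by linarith) hpq
  have hab : a + b = 1 := by
    rw [ha_def, hb_def]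
    field_simp
    ring
  have h0 : e 0 = a * p 0 + b * q 0 := by
    rw [ha_def, hb_def]
    field_simp
    ring
  have h1 : a * p 1 + b * q 1 ≤ e 1 := by
    simp only [dotProduct, Fin.sum_univ_two] at hlp hlq
    have h2 := add_le_add (mul_le_mul_of_nonneg_left hlp ha.le)
      (mul_le_mul_of_nonneg_left hlq hb.le)
    rw [← add_mul, hab, one_mul, h0] at h2
    exact le_of_mul_le_mul_left (by linarith) hl
  have := eq_of_mem_extremePts (r := ![0, e 1 - (a * p 1 + b * q 1)]) he hp hq ha hb hab
    (by intro i; fin_cases i <;> simp [h1])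
    (by funext i; fin_cases i <;> simp [h0])
  exact hpe.ne (by rw [this])

/-! ## Lexicographic optima -/

theorem toLex_fin_three_le {a b c a' b' c' : ℚ} (h : toLex ![a, b, c] ≤ toLex ![a', b', c']) :
    a < a' ∨ (a' = a ∧ (b < b' ∨ (b' = b ∧ c ≤ c'))) := by
  rcases h.eq_or_lt with h | ⟨i, hi, hlt⟩
  · have h := toLex.injective h
    have h0 := congrFun h 0
    have h1 := congrFun h 1
    have h2 := congrFun h 2
    simp at h0 h1 h2
    exact Or.inr ⟨h0.symm, Or.inr ⟨h1.symm, h2.le⟩⟩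
  · fin_cases i
    · exact Or.inl hlt
    · exact Or.inr ⟨(hi 0 (by decide)).symm, Or.inl hlt⟩
    · exact Or.inr ⟨(hi 0 (by decide)).symm, Or.inr ⟨(hi 1 (by decide)).symm, le_of_lt hlt⟩⟩

/-- Prepending a linear functional to a convex lexicographic constraint preserves convexity. -/
theorem convex_lex {E : Type*} [AddCommGroup E] [Module ℝ E] (f : E →ₗ[ℝ] ℝ) (c : ℝ) {G : Set E}
    (hG : Convex ℝ G) : Convex ℝ {z | c < f z ∨ (f z = c ∧ z ∈ G)} := by
  rw [convex_iff_forall_pos]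
  rintro x hx y hy a b ha hb hab
  simp only [Set.mem_ofPred_eq, map_add, map_smul, smul_eq_mul] at hx hy ⊢
  have hc : c = a * c + b * c := by rw [← add_mul, hab, one_mul]
  rcases hx with hx | ⟨hx, hxG⟩ <;> rcases hy with hy | ⟨hy, hyG⟩
  · left
    have := mul_lt_mul_of_pos_left hx ha
    have := mul_lt_mul_of_pos_left hy hb
    linarith
  · left
    have := mul_lt_mul_of_pos_left hx ha
    rw [hy]
    linarith
  · left
    have := mul_lt_mul_of_pos_left hy hb
    rw [hx]
    linarith
  · right
    rw [hx, hy]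
    exact ⟨hc.symm, hG hxG hyG ha.le hb.le hab⟩

/-- The half-plane of the points that are lexicographically not smaller than `y`. -/
def lexAbove (l y : Fin 2 → ℝ) : Set (Fin 2 → ℝ) :=
  {z | l ⬝ᵥ y < l ⬝ᵥ z ∨ (l ⬝ᵥ z = l ⬝ᵥ y ∧ (y 0 < z 0 ∨ (z 0 = y 0 ∧ y 1 ≤ z 1)))}

theorem convex_lexAbove (l y : Fin 2 → ℝ) : Convex ℝ (lexAbove l y) := by
  have h := convex_lex (dotProductBilin ℝ ℝ l) (l ⬝ᵥ y) (convex_lex (LinearMap.proj 0) (y 0)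
    (convex_halfSpace_ge (LinearMap.proj (R := ℝ) (φ := fun _ : Fin 2 => ℝ) 1).isLinear (y 1)))
  exact h

/-- No key of the lexicographic order decreases when `r ≥ 0` is added. The case distinction is on
the first key that increases strictly. -/
theorem add_mem_lexAbove {l y z r : Fin 2 → ℝ} (hl : 0 ≤ l) (hz : z ∈ lexAbove l y) (hr : 0 ≤ r) :
    z + r ∈ lexAbove l y := by
  have h0 : 0 ≤ l ⬝ᵥ r := dotProduct_nonneg_of_nonneg hl hr
  have hr0 : 0 ≤ r 0 := hr 0
  have hr1 : 0 ≤ r 1 := hr 1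
  simp only [lexAbove, Set.mem_ofPred_eq, dotProduct_add, Pi.add_apply] at hz ⊢
  rcases hz with hz | ⟨hz, hz'⟩
  · exact Or.inl (by linarith)
  · rcases h0.eq_or_lt with h0 | h0
    · refine Or.inr ⟨by linarith, ?_⟩
      rcases hz' with hz' | ⟨hz', hz''⟩
      · exact Or.inl (by linarith)
      · rcases hr0.eq_or_lt with hr0 | hr0
        · exact Or.inr ⟨by linarith, by linarith⟩
        · exact Or.inl (by linarith)
    · exact Or.inl (by linarith)

/-- A lexicographic optimum is an extreme point of the lexicographic half-plane. -/
theorem mem_extremePoints_lexAbove (l y : Fin 2 → ℝ) :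
    y ∈ Set.extremePoints ℝ (lexAbove l y) := by
  -- A weighted mean of two numbers that are at least `c` equals `c` only if both do. This is
  -- applied to the three keys in turn; each equality makes the next key the relevant one.
  have key : ∀ {c s t a b : ℝ}, c ≤ s → c ≤ t → 0 < a → 0 < b → a + b = 1 → a * s + b * t = c →
      s = c ∧ t = c := by
    intro c s t a b hs ht ha hb hab h
    have hc : c = a * c + b * c := by rw [← add_mul, hab, one_mul]
    have h1 := mul_le_mul_of_nonneg_left hs ha.le
    have h2 := mul_le_mul_of_nonneg_left ht hb.le
    exact ⟨mul_left_cancel₀ ha.ne' (by linarith), mul_left_cancel₀ hb.ne' (by linarith)⟩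
  refine ⟨Or.inr ⟨rfl, Or.inr ⟨rfl, le_rfl⟩⟩, ?_⟩
  rintro s hs t ht ⟨a, b, ha, hb, hab, h⟩
  have hl : ∀ {z}, z ∈ lexAbove l y → l ⬝ᵥ y ≤ l ⬝ᵥ z := by
    rintro z (hz | ⟨hz, -⟩)
    · exact hz.le
    · exact hz.ge
  have e := congrArg (fun z => l ⬝ᵥ z) h
  simp only [dotProduct_add, dotProduct_smul, smul_eq_mul] at e
  obtain ⟨es, et⟩ := key (hl hs) (hl ht) ha hb hab e
  have hs := (hs.resolve_left es.not_gt).2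
  have ht := (ht.resolve_left et.not_gt).2
  have hl0 : ∀ {z : Fin 2 → ℝ}, (y 0 < z 0 ∨ (z 0 = y 0 ∧ y 1 ≤ z 1)) → y 0 ≤ z 0 := by
    rintro z (hz | ⟨hz, -⟩)
    · exact hz.le
    · exact hz.ge
  obtain ⟨es0, et0⟩ := key (hl0 hs) (hl0 ht) ha hb hab (congrFun h 0)
  have hs := (hs.resolve_left es0.not_gt).2
  have ht := (ht.resolve_left et0.not_gt).2
  obtain ⟨es1, et1⟩ := key hs ht ha hb hab (congrFun h 1)
  funext i
  fin_cases i
  · exact es0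
  · exact es1

theorem IsLexMin.point_mem_points {l : Fin 2 → ℚ} {x : Fin X.n → Bool} (h : X.IsLexMin l x) :
    X.point x ∈ X.points := ⟨x, h.1, rfl⟩

theorem IsLexMin.lex_le {l : Fin 2 → ℚ} {x : Fin X.n → Bool} (h : X.IsLexMin l x)
    {y : Fin 2 → ℚ} (hy : y ∈ X.points) :
    l ⬝ᵥ X.point x < l ⬝ᵥ y ∨ (l ⬝ᵥ y = l ⬝ᵥ X.point x ∧
      (X.point x 0 < y 0 ∨ (y 0 = X.point x 0 ∧ X.point x 1 ≤ y 1))) := by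
  obtain ⟨x', hx', rfl⟩ := hy
  exact toLex_fin_three_le (h.2 x' hx')

theorem IsLexMin.dotProduct_le {l : Fin 2 → ℚ} {x : Fin X.n → Bool} (h : X.IsLexMin l x)
    {y : Fin 2 → ℚ} (hy : y ∈ X.points) : l ⬝ᵥ X.point x ≤ l ⬝ᵥ y := by
  rcases h.lex_le hy with h | ⟨h, -⟩
  · exact h.le
  · exact h.ge

theorem realPoint_dotProduct (l y : Fin 2 → ℚ) :
    realPoint l ⬝ᵥ realPoint y = ((l ⬝ᵥ y : ℚ) : ℝ) := by
  simp [dotProduct, Fin.sum_univ_two, realPoint]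

/-- Lexicographic optima are nondominated extreme points. -/
theorem IsLexMin.mem_extremePts {l : Fin 2 → ℚ} (hl : 0 ≤ l) {x : Fin X.n → Bool}
    (h : X.IsLexMin l x) : X.point x ∈ X.extremePts := by
  have hl' : 0 ≤ realPoint l := fun i => by
    simpa [realPoint] using hl i
  -- A point of a set that is extreme in a larger set is extreme in the set itself. For the
  -- inclusion it suffices to check the points `C x`, by convexity and stability under nonnegative
  -- shifts.
  have hsub : X.upperImage ⊆ lexAbove (realPoint l) (realPoint (X.point x)) := by
    rw [upperImage_eq]
    rintro z ⟨y, hy, r, hr, rfl⟩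
    refine add_mem_lexAbove hl' (convexHull_min ?_ (convex_lexAbove _ _) hy) hr
    rintro _ ⟨y, hy, rfl⟩
    have := h.lex_le hy
    simp only [lexAbove, Set.mem_ofPred_eq, realPoint_dotProduct, realPoint]
    exact_mod_cast this
  refine inter_extremePoints_subset_extremePoints_of_subset hsub
    ⟨?_, mem_extremePoints_lexAbove _ _⟩
  simpa using add_mem_upperImage h.point_mem_points (le_refl (0 : Fin 2 → ℝ))

end BOCOInstance

/-! ## Encoding lengths -/

theorem encInt_le_of_natAbs_le {z : ℤ} {k : ℕ} (h : z.natAbs ≤ 2 ^ k) : encInt z ≤ k + 2 := by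
  have h2 : Nat.clog 2 (z.natAbs + 1) ≤ k + 1 := by
    refine Nat.clog_le_of_le_pow ?_
    have := Nat.one_le_two_pow (n := k)
    rw [pow_succ]
    omega
  unfold encInt
  omega

/-- The sum of the numerator and the denominator of a rational number. -/
def Rat.height (q : ℚ) : ℕ := q.num.natAbs + q.den

theorem Rat.height_le_two_pow (q : ℚ) : q.height ≤ 2 ^ encRat q := by
  have h1 : q.num.natAbs + 1 ≤ 2 ^ Nat.clog 2 (q.num.natAbs + 1) := Nat.le_pow_clog one_lt_two _
  have h2 : q.den + 1 ≤ 2 ^ Nat.clog 2 (q.den + 1) := Nat.le_pow_clog one_lt_two _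
  have h3 : 2 ^ (Nat.clog 2 (q.num.natAbs + 1) + Nat.clog 2 (q.den + 1)) ≤ 2 ^ encRat q := by
    refine Nat.pow_le_pow_right two_pos ?_
    simp only [encRat, encInt, Int.natAbs_natCast]
    omega
  rw [pow_add] at h3
  have h4 := Nat.mul_le_mul h1 h2
  have h5 : q.num.natAbs + q.den ≤ (q.num.natAbs + 1) * (q.den + 1) := by ring_nf; omega
  unfold height
  omega

/-- Reduction to lowest terms only shrinks the numerator and denominator of the usual sum formula,
and `(|a| + b) * (|c| + d)` contains all of `|a| * d + |c| * b + b * d`. -/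
theorem Rat.height_add_le (q r : ℚ) : (q + r).height ≤ q.height * r.height := by
  have h0 : ((q.den : ℤ) * r.den) ≠ 0 := by
    exact_mod_cast mul_ne_zero q.den_nz r.den_nz
  have h1 : (q + r).num.natAbs ≤ q.num.natAbs * r.den + r.num.natAbs * q.den := by
    -- Divisibility bounds the reduced numerator only if the unreduced one is nonzero.
    by_cases h : q.num * r.den + r.num * q.den = 0
    · have h2 : q + r = 0 := by
        rw [← Rat.num_divInt_den q, ← Rat.num_divInt_den r,
          Rat.divInt_add_divInt _ _ (by exact_mod_cast q.den_nz) (by exact_mod_cast r.den_nz), h,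
          Rat.zero_divInt]
      simp [h2]
    · have hd := Rat.num_dvd (q.num * r.den + r.num * q.den) h0
      rw [← Rat.divInt_add_divInt _ _ (by exact_mod_cast q.den_nz) (by exact_mod_cast r.den_nz),
        Rat.num_divInt_den, Rat.num_divInt_den] at hd
      refine (Nat.le_of_dvd (Int.natAbs_pos.2 h) (Int.natAbs_dvd_natAbs.2 hd)).trans
        ((Int.natAbs_add_le _ _).trans ?_)
      simp [Int.natAbs_mul]
  have h2 : (q + r).den ≤ q.den * r.den :=
    Nat.le_of_dvd (Nat.mul_pos q.den_pos r.den_pos) (Rat.add_den_dvd q r)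
  unfold height
  nlinarith [Nat.zero_le (q.num.natAbs * r.num.natAbs)]

theorem Rat.height_sum_le {ι : Type*} (s : Finset ι) (f : ι → ℚ) :
    (∑ i ∈ s, f i).height ≤ ∏ i ∈ s, (f i).height := by
  classical
  induction s using Finset.induction_on with
  | empty => simp [height]
  | insert a s ha ih =>
    rw [Finset.sum_insert ha, Finset.prod_insert ha]
    exact (height_add_le _ _).trans (Nat.mul_le_mul_left _ ih)

/-- Submultiplicativity of the height turns the sum of the encoding lengths of a row into an
exponent. Entries that are not selected contribute the height `1` of zero. -/
theorem BOCOInstance.height_point_le (X : BOCOInstance) (x : Fin X.n → Bool) (i : Fin 2) :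
    (X.point x i).height ≤ 2 ^ X.size := by
  have h1 : ∀ j, (X.C i j * (if x j then 1 else 0)).height ≤ 2 ^ encRat (X.C i j) := by
    intro j
    split_ifs
    · rw [mul_one]
      exact Rat.height_le_two_pow _
    · simpa [Rat.height] using Nat.one_le_two_pow
  have h2 : ∑ j, encRat (X.C i j) ≤ X.size := by
    have h3 : encVec (X.C i) ≤ ∑ i, encVec (X.C i) :=
      Finset.single_le_sum (f := fun i => encVec (X.C i)) (fun _ _ => Nat.zero_le _)
        (Finset.mem_univ i)
    unfold size encMat
    have h4 : ∑ j, encRat (X.C i j) ≤ encVec (X.C i) := Nat.le_add_left _ _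
    omega
  refine (Rat.height_sum_le _ _).trans ((Finset.prod_le_prod' fun j _ => h1 j).trans ?_)
  rw [Finset.prod_pow_eq_pow_sum]
  exact Nat.pow_le_pow_right two_pos h2

/-! ## Runs of straight-line code -/

/-- The machine reaches one configuration from another. -/
def Machine.Steps (M : Machine) : Config → Config → Prop :=
  Relation.ReflTransGen (fun a b => M.step a = some b)

namespace Instr

/-- The cell to which an instruction without control flow writes. -/
def target : Instr → (ℕ → ℤ) → ℕ
  | const d _, _ => d
  | copy d _, _ => d
  | add d _ _, _ => d
  | sub d _ _, _ => d
  | mul d _ _, _ => d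
  | load d _ _, _ => d
  | store a k _, m => (m a).toNat + k
  | _, _ => 0

/-- The value that an instruction without control flow writes. -/
def value : Instr → (ℕ → ℤ) → ℤ
  | const _ z, _ => z
  | copy _ a, m => m a
  | add _ a b, m => m a + m b
  | sub _ a b, m => m a - m b
  | mul _ a b, m => m a * m b
  | load _ a k, m => m ((m a).toNat + k)
  | store _ _ s, m => m s
  | _, _ => 0

/-- The instruction is one of those covered by `target` and `value`, and uses no negative
address. -/
def Regular : Instr → (ℕ → ℤ) → Prop
  | const _ _, _ => True
  | copy _ _, _ => True
  | add _ _ _, _ => True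
  | sub _ _ _, _ => True
  | mul _ _ _, _ => True
  | load _ a _, m => 0 ≤ m a
  | store a _ _, m => 0 ≤ m a
  | _, _ => False

/-- The memory after an instruction. -/
def exec (i : Instr) (m : ℕ → ℤ) : ℕ → ℤ := Function.update m (i.target m) (i.value m)

end Instr

/-- The memory after a block of instructions. -/
def execBlock : List Instr → (ℕ → ℤ) → ℕ → ℤ
  | [], m => m
  | i :: is, m => execBlock is (i.exec m)

/-- Every instruction of the block is regular and writes a number that fits into a cell. -/
def BlockFits (W : ℕ∞) : List Instr → (ℕ → ℤ) → Prop
  | [], _ => True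
  | i :: is, m => i.Regular m ∧ (encInt (i.value m) : ℕ∞) ≤ W ∧ BlockFits W is (i.exec m)

namespace Machine

variable {M : Machine}

theorem Steps.refl (c : Config) : M.Steps c c := Relation.ReflTransGen.refl

theorem Steps.trans {a b c : Config} (h : M.Steps a b) (h' : M.Steps b c) : M.Steps a c :=
  Relation.ReflTransGen.trans h h'

theorem Steps.single {a b : Config} (h : M.step a = some b) : M.Steps a b :=
  Relation.ReflTransGen.single h

theorem step_eq_of_regular {c : Config} {i : Instr} (hi : M.prog[c.pc]? = some i)
    (hr : i.Regular c.mem) :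
    M.step c = c.write M.wordSize (i.target c.mem) (i.value c.mem) := by
  cases i <;> simp_all [step, Instr.Regular, Instr.target, Instr.value]

/-- Symbolic execution: the final memory is given by a recursion that `rfl` and `simp` can evaluate,
and all that remains to prove is that addresses are nonnegative and that the written numbers fit. -/
theorem steps_block (is : List Instr) {p : ℕ} {m : ℕ → ℤ} (out : List (ℕ × List ℤ)) (t : ℕ)
    (hp : is <+: M.prog.drop p) (hf : BlockFits M.wordSize is m) :
    M.Steps ⟨p, m, out, t⟩ ⟨p + is.length, execBlock is m, out, t + is.length⟩ := by
  induction is generalizing p m t with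
  | nil => exact Steps.refl _
  | cons i is ih =>
    obtain ⟨hr, hw, hf⟩ := hf
    have hi : M.prog[p]? = some i := by
      obtain ⟨l, hl⟩ := hp
      have := congrArg (fun l => l[0]?) hl
      simpa using this.symm
    have hp' : is <+: M.prog.drop (p + 1) := by
      obtain ⟨l, hl⟩ := hp
      refine ⟨l, ?_⟩
      rw [← List.tail_drop, ← hl]
      rfl
    have hs : M.step ⟨p, m, out, t⟩ = some ⟨p + 1, i.exec m, out, t + 1⟩ := by
      rw [step_eq_of_regular (c := ⟨p, m, out, t⟩) hi hr, Config.write, if_pos hw]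
      rfl
    have := (Steps.single hs).trans (ih (t + 1) hp' hf)
    simpa only [List.length_cons, execBlock, Nat.add_assoc, Nat.add_comm 1] using this

theorem steps_jump {p q : ℕ} (m : ℕ → ℤ) (out : List (ℕ × List ℤ)) (t : ℕ)
    (hp : M.prog[p]? = some (.jump q)) : M.Steps ⟨p, m, out, t⟩ ⟨q, m, out, t + 1⟩ :=
  Steps.single (by simp [step, hp, Config.goto])

theorem steps_jumpZero {p a q : ℕ} (m : ℕ → ℤ) (out : List (ℕ × List ℤ)) (t : ℕ)
    (hp : M.prog[p]? = some (.jumpZero a q)) :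
    M.Steps ⟨p, m, out, t⟩ ⟨if m a = 0 then q else p + 1, m, out, t + 1⟩ :=
  Steps.single (by simp [step, hp, Config.goto])

theorem steps_jumpNeg {p a q : ℕ} (m : ℕ → ℤ) (out : List (ℕ × List ℤ)) (t : ℕ)
    (hp : M.prog[p]? = some (.jumpNeg a q)) :
    M.Steps ⟨p, m, out, t⟩ ⟨if m a < 0 then q else p + 1, m, out, t + 1⟩ :=
  Steps.single (by simp [step, hp, Config.goto])

theorem steps_emit {p : ℕ} {as : List ℕ} (m : ℕ → ℤ) (out : List (ℕ × List ℤ)) (t : ℕ)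
    (hp : M.prog[p]? = some (.emit as)) :
    M.Steps ⟨p, m, out, t⟩
      ⟨p + 1, m, out ++ [(t + 1 + as.length, as.map m)], t + 1 + as.length⟩ :=
  Steps.single (by simp [step, hp])

theorem steps_call {p d : ℕ} {as : List ℕ} {m : ℕ → ℤ} (out : List (ℕ × List ℤ)) (t : ℕ)
    {ans : List ℤ} {t' : ℕ} (hp : M.prog[p]? = some (.call as d))
    (hs : M.sub (as.map m) = some (ans, t')) (hl : (encInt ans.length : ℕ∞) ≤ M.wordSize)
    (ha : ∀ z ∈ ans, (encInt z : ℕ∞) ≤ M.wordSize) :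
    M.Steps ⟨p, m, out, t⟩
      ⟨p + 1, receive m d ans, out, t + 1 + as.length + t' + ans.length⟩ :=
  Steps.single (by simpa [step, hp, hs, hl] using ha)

/-- The code that replaces the number in cell `d` by its absolute value. -/
theorem exists_steps_abs {p d : ℕ} (m : ℕ → ℤ) (out : List (ℕ × List ℤ)) (t : ℕ) (hd : d ≠ 20)
    (hp : [Instr.jumpNeg d (p + 2), .jump (p + 4), .const 20 0, .sub d 20 d] <+: M.prog.drop p)
    (hW0 : (encInt 0 : ℕ∞) ≤ M.wordSize) (hW : (encInt |m d| : ℕ∞) ≤ M.wordSize) :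
    ∃ m' t', M.Steps ⟨p, m, out, t⟩ ⟨p + 4, m', out, t'⟩ ∧ t' ≤ t + 3 ∧ m' d = |m d| ∧
      ∀ a, a ≠ d → a ≠ 20 → m' a = m a := by
  obtain ⟨l, hl⟩ := hp
  have hi : ∀ j, M.prog[p + j]? =
      ([Instr.jumpNeg d (p + 2), .jump (p + 4), .const 20 0, .sub d 20 d] ++ l)[j]? := by
    intro j
    rw [hl, List.getElem?_drop]
  have h1 := steps_jumpNeg m out t (hi 0)
  by_cases hneg : m d < 0
  · rw [if_pos hneg] at h1
    have h2 := steps_block (M := M) (p := p + 2) (m := m) [.const 20 0, .sub d 20 d] out (t + 1)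
      ⟨l, by rw [← List.drop_drop, ← hl]; rfl⟩
      ⟨trivial, hW0, trivial, by
        simpa [Instr.value, Instr.exec, Instr.target, Function.update_of_ne hd, abs_of_neg hneg]
          using hW, trivial⟩
    refine ⟨_, _, h1.trans h2, by simp, ?_, ?_⟩
    · simp [execBlock, Instr.value, Instr.exec, Instr.target, Function.update_of_ne hd,
        abs_of_neg hneg]
    · intro a ha ha'
      simp [execBlock, Instr.value, Instr.exec, Instr.target, ha, ha']
  · rw [if_neg hneg] at h1
    exact ⟨m, _, h1.trans (steps_jump m out (t + 1) (hi 1)), by omega,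
      (abs_of_nonneg (not_lt.1 hneg)).symm, fun _ _ _ => rfl⟩

/-- The machine is deterministic and `halt` has no successor. This identifies the halting
configuration that `programSubroutine` picks by choice. -/
theorem steps_eq_of_halt {a b c : Config} (hb : M.Steps a b) (hc : M.Steps a c)
    (hb' : M.prog[b.pc]? = some .halt) (hc' : M.prog[c.pc]? = some .halt) : b = c := by
  have hfinal : ∀ {b c : Config}, M.prog[b.pc]? = some .halt → M.Steps b c → b = c := by
    intro b c hb h
    rcases Relation.ReflTransGen.cases_head h with h | ⟨d, hd, -⟩
    · exact h
    · simp [step, hb] at hd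
  rcases Relation.ReflTransGen.total_of_right_unique
    (fun a b c hb hc => Option.some_injective _ (hb.symm.trans hc)) hb hc with h | h
  · exact hfinal hb' h
  · exact (hfinal hc' h).symm

end Machine

/-! ## Programs as subroutines -/

theorem Config.write_mono {c d : Config} {W W' : ℕ∞} (hW : W ≤ W') {a : ℕ} {z : ℤ}
    (h : c.write W a z = some d) : c.write W' a z = some d := by
  unfold Config.write at h ⊢
  split_ifs at h with h1
  rw [if_pos (h1.trans hW)]
  exact h

/-- Runs of programs remain possible when the word size increases. -/
theorem plainMachine_step_mono {A : List Instr} {W W' : ℕ∞} (hW : W ≤ W') {w : List Bool}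
    {c d : Config} (h : (plainMachine A W w).step c = some d) :
    (plainMachine A W' w).step c = some d := by
  unfold Machine.step at h ⊢
  simp only [plainMachine] at h ⊢
  split at h <;> try exact h
  all_goals first
    | exact Config.write_mono hW h
    | (split_ifs at h ⊢; exact Config.write_mono hW h)

/-- The polynomial bound speaks of a run with a word size that depends on the weights, whereas the
subroutine shares the larger word size of its caller. The same run stays possible there, and by
determinism it is the only one that halts. -/
theorem programSubroutine_eq {A : List Instr} {W W' : ℕ∞} (hW : W ≤ W') {w : List Bool}
    {args : List ℤ} {c : Config} (h : (plainMachine A W w).HaltsIn args c) :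
    programSubroutine A W' w args = some (c.answer, c.time) := by
  have h' : (plainMachine A W' w).HaltsIn args c :=
    ⟨Relation.ReflTransGen.mono (fun _ _ => plainMachine_step_mono hW) _ _ h.1, h.2⟩
  have hex : ∃ c, (plainMachine A W' w).HaltsIn args c := ⟨c, h'⟩
  have : hex.choose = c :=
    Machine.steps_eq_of_halt hex.choose_spec.1 h'.1 hex.choose_spec.2 h'.2
  rw [programSubroutine, dif_pos hex, this]

/-! ## The main loop of the Dichotomic Approach -/

/-- A bound for the absolute value of an integer. -/
def Int.Small (k : ℕ) (z : ℤ) : Prop := |z| ≤ 2 ^ k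

namespace Int.Small

variable {j k : ℕ} {a b : ℤ}

theorem mono (h : Int.Small j a) (hjk : j ≤ k) : Int.Small k a :=
  le_trans h (pow_le_pow_right₀ one_le_two hjk)

theorem mul (ha : Int.Small j a) (hb : Int.Small k b) : Int.Small (j + k) (a * b) := by
  unfold Int.Small at *
  rw [abs_mul, pow_add]
  exact mul_le_mul ha hb (abs_nonneg _) (by positivity)

theorem add (ha : Int.Small k a) (hb : Int.Small k b) : Int.Small (k + 1) (a + b) := by
  unfold Int.Small at *
  have := abs_add_le a b
  rw [pow_succ]
  omega

theorem sub (ha : Int.Small k a) (hb : Int.Small k b) : Int.Small (k + 1) (a - b) := by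
  unfold Int.Small at *
  have := abs_sub a b
  rw [pow_succ]
  omega

theorem abs (ha : Int.Small k a) : Int.Small k |a| := by
  unfold Int.Small at *
  rwa [abs_abs]

theorem encInt_le (h : Int.Small k a) : encInt a ≤ k + 2 := by
  refine encInt_le_of_natAbs_le ?_
  unfold Int.Small at h
  rw [Int.abs_eq_natAbs] at h
  exact_mod_cast h

end Int.Small

theorem Rat.small_num {q : ℚ} {k : ℕ} (h : q.height ≤ 2 ^ k) : Int.Small k q.num := by
  have : q.num.natAbs ≤ 2 ^ k := (Nat.le_add_right _ _).trans h
  rw [Int.Small, Int.abs_eq_natAbs]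
  exact_mod_cast this

theorem Rat.small_den {q : ℚ} {k : ℕ} (h : q.height ≤ 2 ^ k) : Int.Small k q.den := by
  have : q.den ≤ 2 ^ k := (Nat.le_add_left _ _).trans h
  rw [Int.Small, Nat.abs_cast]
  exact_mod_cast this

/-! ### Layout of points and queue in the memory -/

/-- Consecutive cells, from a given one on, contain the numbers of a list. -/
def StoredAt (m : ℕ → ℤ) : ℕ → List ℤ → Prop
  | _, [] => True
  | a, z :: zs => m a = z ∧ StoredAt m (a + 1) zs

theorem StoredAt.congr {m m' : ℕ → ℤ} {a : ℕ} {L : List ℤ} (h : StoredAt m a L)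
    (hm : ∀ b, a ≤ b → b < a + L.length → m' b = m b) : StoredAt m' a L := by
  induction L generalizing a with
  | nil => trivial
  | cons z zs ih =>
    simp only [List.length_cons] at hm
    exact ⟨(hm a le_rfl (by omega)).trans h.1,
      ih h.2 fun b hb hb' => hm b (by omega) (by omega)⟩

theorem storedAt_append {m : ℕ → ℤ} {a : ℕ} {L L' : List ℤ} :
    StoredAt m a (L ++ L') ↔ StoredAt m a L ∧ StoredAt m (a + L.length) L' := by
  induction L generalizing a with
  | nil => simp [StoredAt]
  | cons z zs ih =>
    simp only [List.cons_append, StoredAt, ih, List.length_cons, and_assoc, Nat.add_assoc,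
      Nat.add_comm 1]

theorem storedAt_encPoint {m : ℕ → ℤ} {a : ℕ} {y : Fin 2 → ℚ} :
    StoredAt m a (encPoint y) ↔ m a = (y 0).num ∧ m (a + 1) = (y 0).den ∧
      m (a + 2) = (y 1).num ∧ m (a + 3) = (y 1).den := by
  simp [StoredAt, encPoint]

/-- The contents of the queue. -/
def queueCells (Q : List ((Fin 2 → ℚ) × (Fin 2 → ℚ))) : List ℤ :=
  Q.flatMap fun p => encPoint p.1 ++ encPoint p.2

theorem length_queueCells (Q : List ((Fin 2 → ℚ) × (Fin 2 → ℚ))) :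
    (queueCells Q).length = 8 * Q.length := by
  induction Q with
  | nil => rfl
  | cons p Q ih =>
    have : (queueCells (p :: Q)).length = 8 + (queueCells Q).length := by
      simp [queueCells, encPoint]
      omega
    rw [this, ih, List.length_cons]
    omega

/-- The memory at the start of an iteration: the queue is stored in the cells from `h` to
`e - 1`. -/
structure LoopMem (m : ℕ → ℤ) (h e : ℕ) (Q : List ((Fin 2 → ℚ) × (Fin 2 → ℚ))) : Prop where
  one : m 1 = 1
  three : m 3 = 1
  head : m 30 = h
  tail : m 31 = e
  eight : m 32 = 8
  sixteen : m 33 = 16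
  le_head : 40 ≤ h
  tail_eq : e = h + 8 * Q.length
  stored : StoredAt m h (queueCells Q)

/-! ### Integer weights and integer comparison -/

/-- The weights that the Dichotomic Approach uses for a pair of points. -/
def pairWeight (u v : Fin 2 → ℚ) : Fin 2 → ℤ :=
  ![|((u 1).num * (v 1).den - (v 1).num * (u 1).den) * ((u 0).den * (v 0).den)|,
    |((u 0).num * (v 0).den - (v 0).num * (u 0).den) * ((u 1).den * (v 1).den)|]

theorem pairWeight_nonneg (u v : Fin 2 → ℚ) : 0 ≤ pairWeight u v := by
  intro i
  fin_cases i <;> exact abs_nonneg _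

theorem abs_num_mul_den_sub (p q : ℚ) (D : ℕ) :
    ((|(p.num * q.den - q.num * p.den) * D| : ℤ) : ℚ) = |p - q| * (p.den * q.den * D) := by
  have h : ((p.num : ℚ) * q.den - q.num * p.den) * D = (p - q) * (p.den * q.den * D) := by
    rw [← Rat.mul_den_eq_num p, ← Rat.mul_den_eq_num q]
    ring
  push_cast
  rw [h, abs_mul, abs_of_nonneg (show (0 : ℚ) ≤ p.den * q.den * D by positivity)]

/-- Up to a positive factor, the weights are those of the geometric description. -/
theorem exists_pairWeight_eq (u v : Fin 2 → ℚ) : ∃ D : ℚ, 0 < D ∧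
    (pairWeight u v 0 : ℚ) = |u 1 - v 1| * D ∧ (pairWeight u v 1 : ℚ) = |u 0 - v 0| * D := by
  refine ⟨(u 0).den * (v 0).den * ((u 1).den * (v 1).den), ?_, ?_, ?_⟩
  · have := (u 0).den_pos
    have := (u 1).den_pos
    have := (v 0).den_pos
    have := (v 1).den_pos
    positivity
  · have := abs_num_mul_den_sub (u 1) (v 1) ((u 0).den * (v 0).den)
    simp only [Nat.cast_mul] at this
    rw [mul_comm ((u 0).den * (v 0).den : ℚ), ← this]
    rfl
  · have := abs_num_mul_den_sub (u 0) (v 0) ((u 1).den * (v 1).den)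
    simp only [Nat.cast_mul] at this
    rw [← this]
    rfl

/-- The number that the Dichotomic Approach compares with `0`. -/
def lexGap (l : Fin 2 → ℤ) (y u : Fin 2 → ℚ) : ℤ :=
  (l 0 * (y 0).num * (y 1).den + l 1 * (y 1).num * (y 0).den) * (u 0).den * (u 1).den -
    (l 0 * (u 0).num * (u 1).den + l 1 * (u 1).num * (u 0).den) * (y 0).den * (y 1).den

/-- `lexGap` is the difference of the two values times the four denominators, which are nonzero. -/
theorem lexGap_eq_zero_iff (l : Fin 2 → ℤ) (y u : Fin 2 → ℚ) :
    lexGap l y u = 0 ↔ (fun i => (l i : ℚ)) ⬝ᵥ y = (fun i => (l i : ℚ)) ⬝ᵥ u := by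
  have h1 : ((y 0).den : ℚ) ≠ 0 := by exact_mod_cast (y 0).den_nz
  have h2 : ((y 1).den : ℚ) ≠ 0 := by exact_mod_cast (y 1).den_nz
  have h3 : ((u 0).den : ℚ) ≠ 0 := by exact_mod_cast (u 0).den_nz
  have h4 : ((u 1).den : ℚ) ≠ 0 := by exact_mod_cast (u 1).den_nz
  have key : ((lexGap l y u : ℤ) : ℚ) =
      ((l 0 * y 0 + l 1 * y 1) - (l 0 * u 0 + l 1 * u 1)) *
        ((y 0).den * (y 1).den * (u 0).den * (u 1).den) := by
    have e1 := Rat.mul_den_eq_num (y 0)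
    have e2 := Rat.mul_den_eq_num (y 1)
    have e3 := Rat.mul_den_eq_num (u 0)
    have e4 := Rat.mul_den_eq_num (u 1)
    unfold lexGap
    push_cast
    rw [← e1, ← e2, ← e3, ← e4]
    ring
  simp only [dotProduct, Fin.sum_univ_two]
  rw [← @Int.cast_eq_zero ℚ, key, mul_eq_zero, sub_eq_zero]
  simp [h1, h2, h3, h4]

/-- What a run of the Dichotomic Approach on the instance `X` relies on: sufficiently large memory
cells, and answers to lexicographic problems in time `T`. -/
structure RunsOn (M : Machine) (X : BOCOInstance) (T : ℕ) : Prop where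
  prog : M.prog = dichotomicApproach
  -- With `s = X.size`, the comparison multiplies a weight (exponent `4s + 1`) by four numerators or
  -- denominators (`s` each), adds and subtracts: `8s + 3`. Queue addresses need `s + 7`, which
  -- dominates for `s = 0`.
  fits : ∀ z : ℤ, Int.Small (8 * X.size + 10) z → (encInt z : ℕ∞) ≤ M.wordSize
  sub : ∀ l : Fin 2 → ℤ, 0 ≤ l → (∀ i, Int.Small (4 * X.size + 1) (l i)) → ∃ ans t,
    M.sub [l 0, 1, l 1, 1] = some (ans, t) ∧ t ≤ T ∧ IsLexAnswer X (fun i => (l i : ℚ)) ans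

theorem receive_of_notMem {m : ℕ → ℤ} {d a : ℕ} {ans : List ℤ} (h : a < d ∨ d + ans.length < a) :
    receive m d ans a = m a := by
  unfold receive
  rw [if_neg (by omega), if_neg (by omega)]

theorem storedAt_receive (m : ℕ → ℤ) (d : ℕ) (y : Fin 2 → ℚ) :
    StoredAt (receive m d (encPoint y)) (d + 1) (encPoint y) := by
  refine storedAt_encPoint.2 ⟨?_, ?_, ?_, ?_⟩ <;>
  · unfold receive
    rw [if_neg (by omega), if_pos (by simp [encPoint]; try omega)]
    simp [encPoint, Nat.add_assoc]

namespace RunsOn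

variable {M : Machine} {X : BOCOInstance} {T : ℕ}

theorem fits_of_small (hM : RunsOn M X T) {k : ℕ} {z : ℤ} (h : Int.Small k z)
    (hk : k ≤ 8 * X.size + 10) : (encInt z : ℕ∞) ≤ M.wordSize :=
  hM.fits z (h.mono hk)

theorem prefix_drop (hM : RunsOn M X T) {p : ℕ} {is : List Instr}
    (h : is <+: dichotomicApproach.drop p) : is <+: M.prog.drop p := by
  rwa [hM.prog]

theorem fits_encPoint (hM : RunsOn M X T) {y : Fin 2 → ℚ} (hy : ∀ i, (y i).height ≤ 2 ^ X.size) :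
    ∀ z ∈ encPoint y, (encInt z : ℕ∞) ≤ M.wordSize := by
  intro z hz
  simp only [encPoint, List.mem_cons, List.not_mem_nil, or_false] at hz
  rcases hz with rfl | rfl | rfl | rfl
  · exact hM.fits_of_small (Rat.small_num (hy 0)) (by omega)
  · exact hM.fits_of_small (Rat.small_den (hy 0)) (by omega)
  · exact hM.fits_of_small (Rat.small_num (hy 1)) (by omega)
  · exact hM.fits_of_small (Rat.small_den (hy 1)) (by omega)

/-- A call of the subroutine for an instance that has a solution. -/
theorem exists_steps_call (hM : RunsOn M X T) {p : ℕ} {m : ℕ → ℤ} (out : List (ℕ × List ℤ))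
    (t : ℕ) (hp : M.prog[p]? = some (.call [0, 1, 2, 3] 4)) {l : Fin 2 → ℤ} (hl : 0 ≤ l)
    (hs : ∀ i, Int.Small (4 * X.size + 1) (l i)) (h0 : m 0 = l 0) (h1 : m 1 = 1) (h2 : m 2 = l 1)
    (h3 : m 3 = 1) (hX : X.S ≠ ∅) :
    ∃ x m' t', X.IsLexMin (fun i => (l i : ℚ)) x ∧
      M.Steps ⟨p, m, out, t⟩ ⟨p + 1, m', out, t'⟩ ∧ t' ≤ t + T + 9 ∧
      StoredAt m' 5 (encPoint (X.point x)) ∧ m' 4 = 4 ∧ ∀ a, a < 4 ∨ 8 < a → m' a = m a := by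
  obtain ⟨ans, t', hans, ht', hlex⟩ := hM.sub l hl hs
  rcases hlex with ⟨h, -⟩ | ⟨x, hx, rfl⟩
  · exact absurd h hX
  · refine ⟨x, _, _, hx, Machine.steps_call out t hp (by simpa [h0, h1, h2, h3] using hans)
      (hM.fits_of_small (k := 2) (by simp [Int.Small, encPoint]) (by omega))
      (hM.fits_encPoint (X.height_point_le x)), ?_, storedAt_receive m 4 _, rfl, ?_⟩
    · simp [encPoint]
      omega
    · intro a ha
      exact receive_of_notMem (by simpa [encPoint] using ha)

end RunsOn

theorem LoopMem.congr {m m' : ℕ → ℤ} {h e : ℕ} {Q : List ((Fin 2 → ℚ) × (Fin 2 → ℚ))}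
    (hm : LoopMem m h e Q) (h1 : m' 1 = m 1) (h3 : m' 3 = m 3) (hfar : ∀ a, 30 ≤ a → m' a = m a) :
    LoopMem m' h e Q :=
  ⟨h1.trans hm.one, h3.trans hm.three, (hfar 30 (by omega)).trans hm.head,
    (hfar 31 (by omega)).trans hm.tail, (hfar 32 (by omega)).trans hm.eight,
    (hfar 33 (by omega)).trans hm.sixteen, hm.le_head, hm.tail_eq,
    hm.stored.congr fun b hb _ => hfar b (by have := hm.le_head; omega)⟩

namespace RunsOn

variable {M : Machine} {X : BOCOInstance} {T : ℕ}

/-- The instructions that retrieve a pair from the queue. -/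
def retrieveBlock : List Instr := [
  .load 10 30 0, .load 11 30 1, .load 12 30 2, .load 13 30 3,
  .load 14 30 4, .load 15 30 5, .load 16 30 6, .load 17 30 7,
  .add 30 30 32]

theorem exists_steps_retrieve (hM : RunsOn M X T) {m : ℕ → ℤ} {h e : ℕ} {u v : Fin 2 → ℚ}
    {Q : List ((Fin 2 → ℚ) × (Fin 2 → ℚ))} (hm : LoopMem m h e ((u, v) :: Q))
    (he : Int.Small (X.size + 6) e) (hu : ∀ i, (u i).height ≤ 2 ^ X.size)
    (hv : ∀ i, (v i).height ≤ 2 ^ X.size) (out : List (ℕ × List ℤ)) (t : ℕ) :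
    ∃ m', M.Steps ⟨39, m, out, t⟩ ⟨50, m', out, t + 11⟩ ∧ StoredAt m' 10 (encPoint u) ∧
      StoredAt m' 14 (encPoint v) ∧ LoopMem m' (h + 8) e Q := by
  have hlen := hm.tail_eq
  rw [List.length_cons] at hlen
  have hh : Int.Small (X.size + 6) h := by
    unfold Int.Small at *
    rw [Nat.abs_cast] at *
    omega
  have hge := hm.le_head
  have h1 := Machine.steps_block (M := M) (p := 39) (m := m) [.sub 20 31 30] out t
    (hM.prefix_drop ⟨_, rfl⟩)
    ⟨trivial, hM.fits_of_small (k := X.size + 6 + 1)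
      (by simpa [Instr.value, hm.head, hm.tail] using he.sub hh) (by omega), trivial⟩
  have h2 := Machine.steps_jumpZero (M := M) (p := 40) (a := 20) (q := 104)
    (execBlock [.sub 20 31 30] m) out (t + 1) (by rw [hM.prog]; rfl)
  rw [if_neg (by
    simp only [execBlock, Instr.exec, Instr.target, Instr.value, Function.update_self, hm.head,
      hm.tail]
    omega)] at h2
  have hs : StoredAt m h (encPoint u ++ encPoint v ++ queueCells Q) := hm.stored
  obtain ⟨hs, hsQ⟩ := storedAt_append.1 hs
  obtain ⟨hsu, hsv⟩ := storedAt_append.1 hs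
  obtain ⟨hu0, hu1, hu2, hu3⟩ := storedAt_encPoint.1 hsu
  obtain ⟨hv0, hv1, hv2, hv3⟩ := storedAt_encPoint.1 hsv
  simp only [encPoint, List.length_cons, List.length_nil, Nat.reduceAdd,
    Nat.add_assoc] at hv0 hv1 hv2 hv3
  -- The queue lies in cells from 40 on, so the registers loaded here never overwrite entries still
  -- to be read.
  have hne : ∀ k d, d < 40 → h + k ≠ d := fun k d hd => by omega
  have hne0 : ∀ d, d < 40 → h ≠ d := fun d hd => by omega
  have h30 := hm.head
  have h32 := hm.eight
  have hnum : ∀ {y : Fin 2 → ℚ}, (∀ i, (y i).height ≤ 2 ^ X.size) → ∀ i,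
      (encInt (y i).num : ℕ∞) ≤ M.wordSize := fun hy i =>
    hM.fits_of_small (Rat.small_num (hy i)) (by omega)
  have hden : ∀ {y : Fin 2 → ℚ}, (∀ i, (y i).height ≤ 2 ^ X.size) → ∀ i,
      (encInt (y i).den : ℕ∞) ≤ M.wordSize := fun hy i =>
    hM.fits_of_small (Rat.small_den (hy i)) (by omega)
  have h8 : (encInt ((h : ℤ) + 8) : ℕ∞) ≤ M.wordSize := by
    refine hM.fits_of_small (k := X.size + 6 + 1) (hh.add (Int.Small.mono (j := 3) ?_ (by omega)))
      (by omega)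
    simp [Int.Small]
  have h3 := Machine.steps_block (M := M) (p := 41) (m := execBlock [.sub 20 31 30] m)
    retrieveBlock out (t + 2) (hM.prefix_drop ⟨_, rfl⟩) (by
      simp [retrieveBlock, BlockFits, execBlock, Instr.Regular, Instr.value, Instr.target,
        Instr.exec, Function.update_apply, h30, h32, hu0, hu1, hu2, hu3, hv0, hv1, hv2, hv3,
        hne, hne0, hnum hu, hnum hv, hden hu, hden hv, h8])
  refine ⟨_, (h1.trans h2).trans h3, storedAt_encPoint.2 ?_, storedAt_encPoint.2 ?_, ?_⟩
  · simp [retrieveBlock, execBlock, Instr.value, Instr.target,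
        Instr.exec, Function.update_apply, h30, hu0, hu1, hu2, hu3, hne, hne0]
  · simp [retrieveBlock, execBlock, Instr.value, Instr.target,
        Instr.exec, Function.update_apply, h30, hv0, hv1, hv2, hv3, hne, hne0]
  · have hfar : ∀ a, 30 < a → execBlock retrieveBlock (execBlock [.sub 20 31 30] m) a = m a := by
      intro a ha
      have hd : ∀ d, d ≤ 30 → a ≠ d := fun d hd => by omega
      simp [retrieveBlock, execBlock, Instr.target, Instr.exec, hd]
    refine ⟨hm.one, hm.three, ?_, (hfar 31 (by omega)).trans hm.tail,
      (hfar 32 (by omega)).trans hm.eight, (hfar 33 (by omega)).trans hm.sixteen, by omega,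
      by omega, hsQ.congr fun b hb _ => hfar b (by omega)⟩
    simp [retrieveBlock, execBlock, Instr.value, Instr.target, Instr.exec, Function.update_apply,
      h30, h32]

/-- The exponent `4 * X.size + 1` comes from a difference of two products (`2 * X.size + 1`) times
two more denominators. -/
theorem exists_steps_weights (hM : RunsOn M X T) {m : ℕ → ℤ} {u v : Fin 2 → ℚ}
    (hu : ∀ i, (u i).height ≤ 2 ^ X.size) (hv : ∀ i, (v i).height ≤ 2 ^ X.size)
    (hmu : StoredAt m 10 (encPoint u)) (hmv : StoredAt m 14 (encPoint v))
    (out : List (ℕ × List ℤ)) (t : ℕ) :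
    (∀ i, Int.Small (4 * X.size + 1) (pairWeight u v i)) ∧
    ∃ m' t', M.Steps ⟨50, m, out, t⟩ ⟨68, m', out, t'⟩ ∧ t' ≤ t + 16 ∧
      m' 0 = pairWeight u v 0 ∧ m' 2 = pairWeight u v 1 ∧
      ∀ a, a ≠ 0 → a ≠ 2 → (a < 20 ∨ 23 < a) → m' a = m a := by
  obtain ⟨hu0, hu1, hu2, hu3⟩ := storedAt_encPoint.1 hmu
  obtain ⟨hv0, hv1, hv2, hv3⟩ := storedAt_encPoint.1 hmv
  have nu := fun i => Rat.small_num (hu i)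
  have du := fun i => Rat.small_den (hu i)
  have nv := fun i => Rat.small_num (hv i)
  have dv := fun i => Rat.small_den (hv i)
  have f0 : (encInt 0 : ℕ∞) ≤ M.wordSize :=
    hM.fits_of_small (k := 0) (by simp [Int.Small]) (by omega)
  have w0 := (((nu 1).mul (dv 1)).sub ((nv 1).mul (du 1))).mul ((du 0).mul (dv 0))
  have w1 := (((nu 0).mul (dv 0)).sub ((nv 0).mul (du 0))).mul ((du 1).mul (dv 1))
  have fit := fun {k : ℕ} {z : ℤ} => hM.fits_of_small (k := k) (z := z)
  have h1 := Machine.steps_block (M := M) (p := 50) (m := m)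
    [.mul 22 11 15, .mul 23 13 17, .mul 20 12 17, .mul 21 16 13, .sub 0 20 21, .mul 0 0 22] out t
    (hM.prefix_drop ⟨_, rfl⟩) (by
      simp only [BlockFits, Instr.Regular, Instr.value, Instr.target, Instr.exec,
        Function.update_apply, hu1, hu2, hu3, hv1, hv2, hv3, Nat.reduceEqDiff,
        if_true, if_false, true_and, and_true]
      exact ⟨fit ((du 0).mul (dv 0)) (by omega), fit ((du 1).mul (dv 1)) (by omega),
        fit ((nu 1).mul (dv 1)) (by omega), fit ((nv 1).mul (du 1)) (by omega),
        fit (((nu 1).mul (dv 1)).sub ((nv 1).mul (du 1))) (by omega), fit w0 (by omega)⟩)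
  set m1 := execBlock
    [.mul 22 11 15, .mul 23 13 17, .mul 20 12 17, .mul 21 16 13, .sub 0 20 21, .mul 0 0 22] m
    with hm1
  have g0 : m1 0 = ((u 1).num * (v 1).den - (v 1).num * (u 1).den) * ((u 0).den * (v 0).den) := by
    rw [← hu1, ← hu2, ← hu3, ← hv1, ← hv2, ← hv3]
    rfl
  have g23 : m1 23 = (u 1).den * (v 1).den := by
    rw [← hu3, ← hv3]
    rfl
  have g : ∀ a, a ≠ 0 → (a < 20 ∨ 23 < a) → m1 a = m a := by
    intro a ha ha'
    have hd : ∀ d, 20 ≤ d → d ≤ 23 → a ≠ d := fun d _ _ => by omega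
    simp [hm1, execBlock, Instr.target, Instr.exec, hd, ha]
  obtain ⟨m2, t2, h2, ht2, e0, e⟩ := Machine.exists_steps_abs (M := M) (p := 56) (d := 0) m1 out
    (t + 6) (by decide) (hM.prefix_drop ⟨_, rfl⟩) f0 (by
      rw [g0]
      exact fit w0.abs (by omega))
  have h3 := Machine.steps_block (M := M) (p := 60) (m := m2)
    [.mul 20 10 15, .mul 21 14 11, .sub 2 20 21, .mul 2 2 23] out t2
    (hM.prefix_drop ⟨_, rfl⟩) (by
      simp only [BlockFits, Instr.Regular, Instr.value, Instr.target, Instr.exec,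
        Function.update_apply, Nat.reduceEqDiff, if_true, if_false, true_and, and_true,
        e 10 (by decide) (by decide), e 11 (by decide) (by decide), e 14 (by decide) (by decide),
        e 15 (by decide) (by decide), e 23 (by decide) (by decide), g 10 (by decide) (by decide),
        g 11 (by decide) (by decide), g 14 (by decide) (by decide), g 15 (by decide) (by decide),
        g23, hu0, hu1, hv0, hv1]
      exact ⟨fit ((nu 0).mul (dv 0)) (by omega), fit ((nv 0).mul (du 0)) (by omega),
        fit (((nu 0).mul (dv 0)).sub ((nv 0).mul (du 0))) (by omega), fit w1 (by omega)⟩)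
  set m3 := execBlock [.mul 20 10 15, .mul 21 14 11, .sub 2 20 21, .mul 2 2 23] m2 with hm3
  have k2 : m3 2 = ((u 0).num * (v 0).den - (v 0).num * (u 0).den) * ((u 1).den * (v 1).den) := by
    rw [← g23, ← hu0, ← hu1, ← hv0, ← hv1, ← g 10 (by decide) (by decide),
      ← g 11 (by decide) (by decide), ← g 14 (by decide) (by decide),
      ← g 15 (by decide) (by decide), ← e 10 (by decide) (by decide),
      ← e 11 (by decide) (by decide), ← e 14 (by decide) (by decide),
      ← e 15 (by decide) (by decide), ← e 23 (by decide) (by decide)]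
    rfl
  have k : ∀ a, a ≠ 2 → a ≠ 20 → a ≠ 21 → m3 a = m2 a := by
    intro a ha ha' ha''
    simp [hm3, execBlock, Instr.target, Instr.exec, ha, ha', ha'']
  obtain ⟨m4, t4, h4, ht4, i2, i⟩ := Machine.exists_steps_abs (M := M) (p := 64) (d := 2) m3 out
    (t2 + 4) (by decide) (hM.prefix_drop ⟨_, rfl⟩) f0 (by
      rw [k2]
      exact fit w1.abs (by omega))
  refine ⟨?_, m4, t4, ((h1.trans h2).trans h3).trans h4, by omega, ?_, ?_, ?_⟩
  · intro j
    fin_cases j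
    · exact w0.abs.mono (by omega)
    · exact w1.abs.mono (by omega)
  · rw [i 0 (by decide) (by decide), k 0 (by decide) (by decide) (by decide), e0, g0]
    rfl
  · rw [i2, k2]
    rfl
  · intro a h0 h2 ha
    rw [i a h2 (by omega), k a h2 (by omega) (by omega), e a h0 (by omega), g a h0 ha]

/-- The instructions that compare the values of two points. -/
def compareBlock : List Instr := [
  .mul 20 0 5, .mul 20 20 8, .mul 21 2 7, .mul 21 21 6, .add 20 20 21,
  .mul 20 20 11, .mul 20 20 13,
  .mul 22 0 10, .mul 22 22 13, .mul 23 2 12, .mul 23 23 11, .add 22 22 23,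
  .mul 22 22 6, .mul 22 22 8,
  .sub 20 20 22]

theorem exists_steps_compare (hM : RunsOn M X T) {m : ℕ → ℤ} {y u : Fin 2 → ℚ} {l : Fin 2 → ℤ}
    (hu : ∀ i, (u i).height ≤ 2 ^ X.size) (hy : ∀ i, (y i).height ≤ 2 ^ X.size)
    (hl : ∀ i, Int.Small (4 * X.size + 1) (l i)) (h0 : m 0 = l 0) (h2 : m 2 = l 1)
    (hmu : StoredAt m 10 (encPoint u)) (hmy : StoredAt m 5 (encPoint y))
    (out : List (ℕ × List ℤ)) (t : ℕ) :
    ∃ m', M.Steps ⟨69, m, out, t⟩ ⟨if lexGap l y u = 0 then 39 else 85, m', out, t + 16⟩ ∧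
      ∀ a, (a < 20 ∨ 23 < a) → m' a = m a := by
  obtain ⟨hu0, hu1, hu2, hu3⟩ := storedAt_encPoint.1 hmu
  obtain ⟨hy0, hy1, hy2, hy3⟩ := storedAt_encPoint.1 hmy
  have nu := fun i => Rat.small_num (hu i)
  have du := fun i => Rat.small_den (hu i)
  have ny := fun i => Rat.small_num (hy i)
  have dy := fun i => Rat.small_den (hy i)
  have fit := fun {k : ℕ} {z : ℤ} => hM.fits_of_small (k := k) (z := z)
  have a0 := ((hl 0).mul (ny 0)).mul (dy 1)
  have a1 := ((hl 1).mul (ny 1)).mul (dy 0)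
  have b0 := ((hl 0).mul (nu 0)).mul (du 1)
  have b1 := ((hl 1).mul (nu 1)).mul (du 0)
  have a2 := a0.add a1
  have b2 := b0.add b1
  have a3 := (a2.mul (du 0)).mul (du 1)
  have b3 := (b2.mul (dy 0)).mul (dy 1)
  have hgap : execBlock compareBlock m 20 = lexGap l y u := by
    rw [lexGap, ← h0, ← h2, ← hu0, ← hu1, ← hu2, ← hu3, ← hy0, ← hy1, ← hy2, ← hy3]
    rfl
  have h1 := Machine.steps_block (M := M) (p := 69) (m := m) compareBlock out t
    (hM.prefix_drop ⟨_, rfl⟩) (by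
      simp only [compareBlock, BlockFits, Instr.Regular, Instr.value, Instr.target, Instr.exec,
        Function.update_apply, h0, h2, hu0, hu1, hu2, hu3, hy0, hy1, hy2, hy3, Nat.reduceEqDiff,
        if_true, if_false, true_and, and_true]
      exact ⟨fit ((hl 0).mul (ny 0)) (by omega), fit a0 (by omega),
        fit ((hl 1).mul (ny 1)) (by omega), fit a1 (by omega), fit a2 (by omega),
        fit (a2.mul (du 0)) (by omega), fit a3 (by omega),
        fit ((hl 0).mul (nu 0)) (by omega), fit b0 (by omega),
        fit ((hl 1).mul (nu 1)) (by omega), fit b1 (by omega), fit b2 (by omega),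
        fit (b2.mul (dy 0)) (by omega), fit b3 (by omega), fit (a3.sub b3) (by omega)⟩)
  have h3 := Machine.steps_jumpZero (M := M) (p := 84) (a := 20) (q := 39)
    (execBlock compareBlock m) out (t + 15) (by rw [hM.prog]; rfl)
  rw [hgap] at h3
  refine ⟨_, h1.trans h3, ?_⟩
  intro a ha
  have hd : ∀ d, 20 ≤ d → d ≤ 23 → a ≠ d := fun d _ _ => by omega
  simp [compareBlock, execBlock, Instr.target, Instr.exec, hd]

/-- An iteration of the main loop, up to the comparison of the values of the two points. -/
theorem exists_steps_iteration (hM : RunsOn M X T) {m : ℕ → ℤ} {h e : ℕ} {u v : Fin 2 → ℚ}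
    {Q : List ((Fin 2 → ℚ) × (Fin 2 → ℚ))} (hm : LoopMem m h e ((u, v) :: Q))
    (he : Int.Small (X.size + 6) e) (hu : ∀ i, (u i).height ≤ 2 ^ X.size)
    (hv : ∀ i, (v i).height ≤ 2 ^ X.size) (hX : X.S ≠ ∅) (out : List (ℕ × List ℤ)) (t : ℕ) :
    ∃ x m' t', X.IsLexMin (fun i => (pairWeight u v i : ℚ)) x ∧
      M.Steps ⟨39, m, out, t⟩
        ⟨if lexGap (pairWeight u v) (X.point x) u = 0 then 39 else 85, m', out, t'⟩ ∧
      t' ≤ t + T + 60 ∧ StoredAt m' 5 (encPoint (X.point x)) ∧ StoredAt m' 10 (encPoint u) ∧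
      StoredAt m' 14 (encPoint v) ∧ LoopMem m' (h + 8) e Q := by
  obtain ⟨m1, s1, u1, v1, l1⟩ := hM.exists_steps_retrieve hm he hu hv out t
  obtain ⟨hs, m2, t2, s2, ht2, w0, w1, e2⟩ := hM.exists_steps_weights hu hv u1 v1 out (t + 11)
  obtain ⟨x, m3, t3, hx, s3, ht3, y3, -, e3⟩ := hM.exists_steps_call (p := 68) out t2
    (by rw [hM.prog]; rfl) (pairWeight_nonneg u v) hs w0
    ((e2 1 (by decide) (by decide) (by decide)).trans l1.one) w1
    ((e2 3 (by decide) (by decide) (by decide)).trans l1.three) hX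
  have e3' : ∀ a, 10 ≤ a → a < 18 → m3 a = m1 a := fun a ha ha' =>
    (e3 a (by omega)).trans (e2 a (by omega) (by omega) (by omega))
  have u3 : StoredAt m3 10 (encPoint u) := u1.congr fun b hb hb' => by
    simp only [encPoint, List.length_cons, List.length_nil] at hb'
    exact e3' b (by omega) (by omega)
  have v3 : StoredAt m3 14 (encPoint v) := v1.congr fun b hb hb' => by
    simp only [encPoint, List.length_cons, List.length_nil] at hb'
    exact e3' b (by omega) (by omega)
  obtain ⟨m4, s4, e4⟩ := hM.exists_steps_compare hu (X.height_point_le x) hs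
    ((e3 0 (by decide)).trans w0) ((e3 2 (by decide)).trans w1) u3 y3 out t3
  have near : ∀ {y : Fin 2 → ℚ} {a : ℕ}, a + 4 ≤ 20 → StoredAt m3 a (encPoint y) →
      StoredAt m4 a (encPoint y) := fun ha hy => hy.congr fun b hb hb' => by
    simp only [encPoint, List.length_cons, List.length_nil] at hb'
    exact e4 b (by omega)
  refine ⟨x, m4, _, hx, ((s1.trans s2).trans s3).trans s4, by omega, near (by omega) y3,
    near (by omega) u3, near (by omega) v3, l1.congr ?_ ?_ ?_⟩
  · rw [e4 1 (by decide), e3 1 (by decide), e2 1 (by decide) (by decide) (by decide)]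
  · rw [e4 3 (by decide), e3 3 (by decide), e2 3 (by decide) (by decide) (by decide)]
  · intro a ha
    rw [e4 a (by omega), e3 a (by omega), e2 a (by omega) (by omega) (by omega)]

/-- The instructions that append two pairs to the queue. -/
def appendBlock : List Instr := [
  .store 31 0 5, .store 31 1 6, .store 31 2 7, .store 31 3 8,
  .store 31 4 10, .store 31 5 11, .store 31 6 12, .store 31 7 13,
  .store 31 8 5, .store 31 9 6, .store 31 10 7, .store 31 11 8,
  .store 31 12 14, .store 31 13 15, .store 31 14 16, .store 31 15 17,
  .add 31 31 33]

/-- The end of an iteration in which a new point has been found. -/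
theorem exists_steps_append (hM : RunsOn M X T) {m : ℕ → ℤ} {h e : ℕ} {y u v : Fin 2 → ℚ}
    {Q : List ((Fin 2 → ℚ) × (Fin 2 → ℚ))} (hm : LoopMem m h e Q)
    (he : Int.Small (X.size + 6) e) (hy : ∀ i, (y i).height ≤ 2 ^ X.size)
    (hu : ∀ i, (u i).height ≤ 2 ^ X.size) (hv : ∀ i, (v i).height ≤ 2 ^ X.size)
    (hmy : StoredAt m 5 (encPoint y)) (hmu : StoredAt m 10 (encPoint u))
    (hmv : StoredAt m 14 (encPoint v)) (out : List (ℕ × List ℤ)) (t : ℕ) :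
    ∃ m', M.Steps ⟨85, m, out, t⟩ ⟨39, m', out ++ [(t + 5, encPoint y)], t + 23⟩ ∧
      LoopMem m' h (e + 16) (Q ++ [(y, u), (y, v)]) := by
  obtain ⟨hu0, hu1, hu2, hu3⟩ := storedAt_encPoint.1 hmu
  obtain ⟨hv0, hv1, hv2, hv3⟩ := storedAt_encPoint.1 hmv
  obtain ⟨hy0, hy1, hy2, hy3⟩ := storedAt_encPoint.1 hmy
  have h1 := Machine.steps_emit (M := M) (p := 85) (as := [5, 6, 7, 8]) m out t
    (by rw [hM.prog]; rfl)
  have hrec : [5, 6, 7, 8].map m = encPoint y := by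
    simp [encPoint, hy0, hy1, hy2, hy3]
  rw [hrec] at h1
  have hlen := hm.tail_eq
  have hge := hm.le_head
  have hne : ∀ k d, d < 40 → e + k ≠ d := fun k d hd => by omega
  have hne0 : ∀ d, d < 40 → e ≠ d := fun d hd => by omega
  have hne' : ∀ k d, d < 40 → d ≠ e + k := fun k d hd => by omega
  have hne0' : ∀ d, d < 40 → d ≠ e := fun d hd => by omega
  have hpos : e ≠ 0 := by omega
  have h31 := hm.tail
  have h33 := hm.sixteen
  have hnum : ∀ {y : Fin 2 → ℚ}, (∀ i, (y i).height ≤ 2 ^ X.size) → ∀ i,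
      (encInt (y i).num : ℕ∞) ≤ M.wordSize := fun hy i =>
    hM.fits_of_small (Rat.small_num (hy i)) (by omega)
  have hden : ∀ {y : Fin 2 → ℚ}, (∀ i, (y i).height ≤ 2 ^ X.size) → ∀ i,
      (encInt (y i).den : ℕ∞) ≤ M.wordSize := fun hy i =>
    hM.fits_of_small (Rat.small_den (hy i)) (by omega)
  have h16 : (encInt ((e : ℤ) + 16) : ℕ∞) ≤ M.wordSize := by
    refine hM.fits_of_small (k := X.size + 6 + 1) (he.add (Int.Small.mono (j := 4) ?_ (by omega)))
      (by omega)
    simp [Int.Small]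
  have h2 := Machine.steps_block (M := M) (p := 86) (m := m) appendBlock
    (out ++ [(t + 5, encPoint y)]) (t + 5) (hM.prefix_drop ⟨_, rfl⟩) (by
      simp [appendBlock, BlockFits, Instr.Regular, Instr.value, Instr.target,
        Instr.exec, Function.update_apply, h31, h33, hu0, hu1, hu2, hu3, hv0, hv1, hv2, hv3,
        hy0, hy1, hy2, hy3, hne', hne0', hpos, hnum hu, hnum hv, hnum hy, hden hu, hden hv,
        hden hy, h16])
  have h3 := Machine.steps_jump (M := M) (p := 103) (q := 39) (execBlock appendBlock m)
    (out ++ [(t + 5, encPoint y)]) (t + 22) (by rw [hM.prog]; rfl)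
  refine ⟨_, (h1.trans h2).trans h3, ?_⟩
  have hfar : ∀ a, a ≠ 31 → a < e → execBlock appendBlock m a = m a := by
    intro a ha ha'
    have hd : ∀ k, a ≠ e + k := fun k => by omega
    have hd0 : a ≠ e := by omega
    simp [appendBlock, execBlock, Instr.target, Instr.exec, Function.update_apply, h31, ha, hd, hd0,
      hne0', hne']
  have hcells : queueCells (Q ++ [(y, u), (y, v)]) =
      queueCells Q ++ (encPoint y ++ encPoint u ++ (encPoint y ++ encPoint v)) := by
    simp [queueCells]
  refine ⟨(hfar 1 (by omega) (by omega)).trans hm.one, (hfar 3 (by omega) (by omega)).trans hm.three,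
    (hfar 30 (by omega) (by omega)).trans hm.head, ?_,
    (hfar 32 (by omega) (by omega)).trans hm.eight,
    (hfar 33 (by omega) (by omega)).trans hm.sixteen, hge, ?_, ?_⟩
  · simp [appendBlock, execBlock, Instr.value, Instr.target, Instr.exec, Function.update_apply, h31,
      h33, hne0', hne']
  · simp
    omega
  · rw [hcells, storedAt_append, length_queueCells, ← hlen]
    refine ⟨hm.stored.congr fun b hb hb' => ?_, ?_⟩
    · rw [length_queueCells] at hb'
      exact hfar b (by omega) (by omega)
    · simp [StoredAt, encPoint, appendBlock, execBlock, Instr.value, Instr.target, Instr.exec,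
        Function.update_apply, h31, hne', hne0', hne, hne0, hu0, hu1, hu2, hu3, hv0, hv1, hv2, hv3,
        hy0, hy1, hy2, hy3, Nat.add_assoc]

end RunsOn

/-! ## The invariant of the Dichotomic Approach -/

/-- The first component of `e` lies strictly between those of the two points of the pair. -/
def isBetween (e : Fin 2 → ℚ) (p : (Fin 2 → ℚ) × (Fin 2 → ℚ)) : Bool :=
  decide ((p.1 0 < e 0 ∧ e 0 < p.2 0) ∨ (p.2 0 < e 0 ∧ e 0 < p.1 0))

theorem isBetween_iff {e u v : Fin 2 → ℚ} :
    isBetween e (u, v) = true ↔ (u 0 < e 0 ∧ e 0 < v 0) ∨ (v 0 < e 0 ∧ e 0 < u 0) := by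
  simp [isBetween]

/-- Every nondominated extreme point either has been output once, or lies between the points of
exactly one pair of the queue. -/
structure SearchInv (X : BOCOInstance) (ys : List (Fin 2 → ℚ))
    (Q : List ((Fin 2 → ℚ) × (Fin 2 → ℚ))) : Prop where
  mem : ∀ y ∈ ys, y ∈ X.extremePts
  pair : ∀ p ∈ Q, p.1 ∈ X.extremePts ∧ p.2 ∈ X.extremePts ∧ p.1 0 ≠ p.2 0
  count : ∀ e ∈ X.extremePts, ys.count e + Q.countP (isBetween e) = 1

open BOCOInstance

variable {X : BOCOInstance}

/-- Of two extreme points, the one with the smaller first component has the larger second one. So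
the absolute differences form a normal vector of the line through `u` and `v`. -/
theorem pairWeight_dotProduct {u v : Fin 2 → ℚ} (hu : u ∈ X.extremePts) (hv : v ∈ X.extremePts)
    (h : u 0 ≠ v 0) : (0 : ℚ) < pairWeight u v 1 ∧
      (fun i => (pairWeight u v i : ℚ)) ⬝ᵥ u = (fun i => (pairWeight u v i : ℚ)) ⬝ᵥ v := by
  obtain ⟨D, hD, h0, h1⟩ := exists_pairWeight_eq u v
  refine ⟨by rw [h1]; exact mul_pos (abs_pos.2 (sub_ne_zero.2 h)) hD, ?_⟩
  simp only [dotProduct, Fin.sum_univ_two, h0, h1]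
  rcases lt_or_gt_of_ne h with h | h
  · have h' := extremePts_snd_lt hu hv h
    rw [abs_of_pos (by linarith : 0 < u 1 - v 1), abs_of_neg (by linarith : u 0 - v 0 < 0)]
    ring
  · have h' := extremePts_snd_lt hv hu h
    rw [abs_of_neg (by linarith : u 1 - v 1 < 0), abs_of_pos (by linarith : 0 < u 0 - v 0)]
    ring

/-- A better extreme point lies between two extreme points of equal value. -/
theorem lt_and_lt_of_dotProduct_lt {u v y l : Fin 2 → ℚ} (hu : u ∈ X.extremePts)
    (hv : v ∈ X.extremePts) (hy : y ∈ X.extremePts) (huv : u 0 < v 0) (hl : 0 < l 1)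
    (heq : l ⬝ᵥ u = l ⬝ᵥ v) (hlt : l ⬝ᵥ y < l ⬝ᵥ u) : u 0 < y 0 ∧ y 0 < v 0 := by
  have hyu : y ≠ u := fun h => by simp [h] at hlt
  have hyv : y ≠ v := fun h => by simp [h, heq] at hlt
  constructor
  -- With `y` to the left of `u`, the extreme point `u` would lie between `y` and `v`, neither of
  -- which has a larger value. The other side is symmetric.
  · by_contra! h
    have h' : y 0 < u 0 := lt_of_le_of_ne h fun h => hyu (extremePts_eq_of_fst_eq hy hu h)
    exact not_le_of_mem_extremePts hu (extremePts_subset_points hy) (extremePts_subset_points hv)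
      h' huv hl hlt.le heq.ge
  · by_contra! h
    have h' : v 0 < y 0 := lt_of_le_of_ne h fun h => hyv (extremePts_eq_of_fst_eq hy hv h.symm)
    exact not_le_of_mem_extremePts hv (extremePts_subset_points hu) (extremePts_subset_points hy)
      huv h' hl heq.le (heq ▸ hlt.le)

namespace SearchInv

variable {ys : List (Fin 2 → ℚ)} {Q : List ((Fin 2 → ℚ) × (Fin 2 → ℚ))}

theorem nodup (h : SearchInv X ys Q) : ys.Nodup := by
  rw [List.nodup_iff_count_le_one]
  intro e
  by_cases he : e ∈ ys
  · have := h.count e (h.mem e he)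
    omega
  · rw [List.count_eq_zero_of_not_mem he]
    omega

/-- Different outputs come from different 0-1 vectors. The bound serves both termination and the
length of the queue addresses. -/
theorem length_le (h : SearchInv X ys Q) : ys.length ≤ 2 ^ X.n := by
  classical
  have hsub : ys.toFinset ⊆ Finset.univ.image X.point := by
    intro y hy
    obtain ⟨x, -, hx⟩ := extremePts_subset_points (h.mem y (List.mem_toFinset.1 hy))
    exact Finset.mem_image.2 ⟨x, Finset.mem_univ x, hx⟩
  rw [← List.toFinset_card_of_nodup h.nodup]
  refine (Finset.card_le_card hsub).trans (Finset.card_image_le.trans ?_)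
  simp

/-- An extreme point other than `y` lies strictly to the right of `y`. If it were not to the left of
`z`, it would be dominated by `z`, whose second component is minimal. -/
theorem start {y z : Fin 2 → ℚ} (hy : y ∈ X.extremePts) (hz : z ∈ X.extremePts) (hne : y ≠ z)
    (hy0 : ∀ e ∈ X.extremePts, y 0 ≤ e 0) (hz1 : ∀ e ∈ X.extremePts, z 1 ≤ e 1) :
    SearchInv X [y, z] [(y, z)] := by
  refine ⟨by simp [hy, hz], ?_, ?_⟩
  · simp only [List.mem_singleton, forall_eq]
    exact ⟨hy, hz, fun h => hne (extremePts_eq_of_fst_eq hy hz h)⟩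
  · intro e he
    have hyz : y 0 < z 0 :=
      lt_of_le_of_ne (hy0 z hz) fun h => hne (extremePts_eq_of_fst_eq hy hz h)
    by_cases hey : y = e
    · subst hey
      simp [isBetween_iff, hne.symm, hyz.not_gt]
    · by_cases hez : z = e
      · subst hez
        simp [isBetween_iff, hne, hyz.not_gt]
      · have h1 : y 0 < e 0 :=
          lt_of_le_of_ne (hy0 e he) fun h => hey (extremePts_eq_of_fst_eq hy he h)
        have h2 : e 0 < z 0 := by
          by_contra! h2
          exact hez (eq_of_le_of_mem_extremePts he (extremePts_subset_points hz) h2 (hz1 e he))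
        simp [isBetween_iff, hey, hez, h1, h2]

/-- All points have at least the common value of `u` and `v`, but an extreme point between the two
would be strictly better. So the pair contributes nothing to any count. -/
theorem discard {u v : Fin 2 → ℚ} (h : SearchInv X ys ((u, v) :: Q)) {x : Fin X.n → Bool}
    (hx : X.IsLexMin (fun i => (pairWeight u v i : ℚ)) x)
    (heq : (fun i => (pairWeight u v i : ℚ)) ⬝ᵥ X.point x =
      (fun i => (pairWeight u v i : ℚ)) ⬝ᵥ u) : SearchInv X ys Q := by
  obtain ⟨hu, hv, hne⟩ := h.pair _ List.mem_cons_self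
  obtain ⟨hl, hluv⟩ := pairWeight_dotProduct hu hv hne
  refine ⟨h.mem, fun p hp => h.pair p (List.mem_cons_of_mem _ hp), fun e he => ?_⟩
  have hc := h.count e he
  have hlu := hx.dotProduct_le (extremePts_subset_points he)
  rw [heq] at hlu
  have hlv := hlu
  rw [hluv] at hlv
  have hb : ¬ isBetween e (u, v) = true := by
    rw [isBetween_iff]
    rintro (⟨h1, h2⟩ | ⟨h1, h2⟩)
    · exact not_le_of_mem_extremePts he (extremePts_subset_points hu)
        (extremePts_subset_points hv) h1 h2 hl hlu hlv
    · exact not_le_of_mem_extremePts he (extremePts_subset_points hv)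
        (extremePts_subset_points hu) h1 h2 hl hlv hlu
  rwa [List.countP_cons_of_neg hb] at hc

/-- The new point improves on both `u` and `v`, hence lies strictly between them. Since extreme
points are determined by their first component, those between `u` and `v` are the new point, those
between it and `u`, and those between it and `v`, without overlap. -/
theorem extend {u v : Fin 2 → ℚ} (h : SearchInv X ys ((u, v) :: Q)) {x : Fin X.n → Bool}
    (hx : X.IsLexMin (fun i => (pairWeight u v i : ℚ)) x)
    (hneq : (fun i => (pairWeight u v i : ℚ)) ⬝ᵥ X.point x ≠
      (fun i => (pairWeight u v i : ℚ)) ⬝ᵥ u) :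
    SearchInv X (ys ++ [X.point x]) (Q ++ [(X.point x, u), (X.point x, v)]) := by
  obtain ⟨hu, hv, hne⟩ := h.pair _ List.mem_cons_self
  obtain ⟨hl, hluv⟩ := pairWeight_dotProduct hu hv hne
  have hy : X.point x ∈ X.extremePts := hx.mem_extremePts fun i =>
    Int.cast_nonneg (pairWeight_nonneg u v i)
  have hlt := lt_of_le_of_ne (hx.dotProduct_le (extremePts_subset_points hu)) hneq
  generalize X.point x = y at *
  have hb : (u 0 < y 0 ∧ y 0 < v 0) ∨ (v 0 < y 0 ∧ y 0 < u 0) := by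
    rcases lt_or_gt_of_ne hne with h | h
    · exact Or.inl (lt_and_lt_of_dotProduct_lt hu hv hy h hl hluv hlt)
    · exact Or.inr (lt_and_lt_of_dotProduct_lt hv hu hy h hl hluv.symm (hluv ▸ hlt))
  refine ⟨?_, ?_, ?_⟩
  · intro z hz
    rcases List.mem_append.1 hz with hz | hz
    · exact h.mem z hz
    · rwa [List.mem_singleton.1 hz]
  · intro p hp
    rcases List.mem_append.1 hp with hp | hp
    · exact h.pair p (List.mem_cons_of_mem _ hp)
    · simp only [List.mem_cons, List.not_mem_nil, or_false] at hp
      rcases hp with rfl | rfl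
      · exact ⟨hy, hu, by rcases hb with hb | hb; exacts [hb.1.ne', hb.2.ne]⟩
      · exact ⟨hy, hv, by rcases hb with hb | hb; exacts [hb.2.ne, hb.1.ne']⟩
  · intro e he
    have hc := h.count e he
    rw [List.countP_cons] at hc
    rw [List.count_append, List.countP_append, List.countP_cons, List.countP_singleton,
      List.count_singleton]
    have hye : y = e ∨ y 0 < e 0 ∨ e 0 < y 0 := by
      rcases lt_trichotomy (y 0) (e 0) with h | h | h
      · exact Or.inr (Or.inl h)
      · exact Or.inl (extremePts_eq_of_fst_eq hy he h)
      · exact Or.inr (Or.inr h)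
    have key : (if isBetween e (u, v) = true then 1 else 0) = (if (y == e) = true then 1 else 0) +
        ((if isBetween e (y, v) = true then 1 else 0) +
          if isBetween e (y, u) = true then 1 else 0) := by
      simp only [isBetween_iff, beq_iff_eq]
      rcases hye with rfl | hye
      · simp [hb]
      · have : y ≠ e := by
          rintro rfl
          simp at hye
        simp only [this, if_false]
        grind
    omega

theorem eq_extremePts (h : SearchInv X ys []) : {y | y ∈ ys} = X.extremePts := by
  ext y
  refine ⟨h.mem y, fun hy => ?_⟩
  have := h.count y hy
  simp only [List.countP_nil, Nat.add_zero] at this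
  exact List.count_pos_iff.1 (by omega)

end SearchInv

/-! ## Delays -/

theorem Config.delay_of_out_append {c d : Config} {s : ℕ} {r : List ℤ}
    (h : d.out = c.out ++ [(s, r)]) {i : ℕ} (hi : i < c.out.length) : d.delay i = c.delay i := by
  unfold Config.delay
  rw [h]
  simp only [List.map_append, List.map_cons, List.map_nil, List.append_assoc]
  rw [← List.cons_append, List.getD_append _ _ _ _ (by simpa using hi),
    List.getD_append _ _ _ _ (by simpa using hi.le),
    List.getD_append _ _ _ _ (by simp; omega)]

/-- The time of a configuration enters only the delay with index `out.length`; all earlier delays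
are settled by the records. -/
theorem Config.delay_eq_of_lt {p p' : ℕ} {m m' : ℕ → ℤ} {out : List (ℕ × List ℤ)} {t t' i : ℕ}
    (hi : i < out.length) : Config.delay ⟨p, m, out, t⟩ i = Config.delay ⟨p', m', out, t'⟩ i := by
  unfold Config.delay
  rw [List.getD_append _ _ _ _ (by simpa using hi), List.getD_append _ _ _ _ (by simpa using hi)]

/-- The time of the last output, `0` if there is none. -/
def Config.lastTime (c : Config) : ℕ := (0 :: c.out.map Prod.fst).getD c.out.length 0

theorem Config.delay_length (c : Config) : c.delay c.out.length = c.time - c.lastTime := by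
  unfold Config.delay Config.lastTime
  rw [List.getD_append_right _ _ _ _ (by simp)]
  simp

theorem Config.delay_length_of_out_append {c d : Config} {s : ℕ} {r : List ℤ}
    (h : d.out = c.out ++ [(s, r)]) : d.delay c.out.length = s - c.lastTime := by
  unfold Config.delay Config.lastTime
  rw [h]
  simp only [List.map_append, List.map_cons, List.map_nil, List.append_assoc]
  rw [show 0 :: (c.out.map Prod.fst ++ [s]) = (0 :: c.out.map Prod.fst) ++ [s] from rfl,
    List.getD_append (0 :: c.out.map Prod.fst) _ _ _ (by simp),
    List.getD_append_right _ _ _ _ (by simp)]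
  simp

theorem Config.lastTime_of_out_append {c d : Config} {s : ℕ} {r : List ℤ}
    (h : d.out = c.out ++ [(s, r)]) : d.lastTime = s := by
  unfold Config.lastTime
  rw [h]
  simp

/-! ## The run of the Dichotomic Approach -/

theorem enumeratesExtremePoints_of_records {X : BOCOInstance} {c : Config}
    {ys : List (Fin 2 → ℚ)} (hc : c.out.map Prod.snd = ys.map encPoint) (hnd : ys.Nodup)
    (hys : {y | y ∈ ys} = X.extremePts) : EnumeratesExtremePoints X c := by
  refine ⟨ys, hc, hnd, ?_⟩
  rw [← BOCOInstance.realPoint_image_extremePts, ← hys]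
  ext z
  constructor
  · rintro ⟨y, hy, rfl⟩
    exact ⟨y, hy, rfl⟩
  · rintro ⟨y, hy, rfl⟩
    exact ⟨y, hy, rfl⟩

/-- The state of the Dichotomic Approach at the start of an iteration; `D` bounds the time of an
iteration. -/
structure LoopInv (X : BOCOInstance) (D : ℕ) (c : Config) (ys : List (Fin 2 → ℚ))
    (Q : List ((Fin 2 → ℚ) × (Fin 2 → ℚ))) (h : ℕ) : Prop where
  pc : c.pc = 39
  memory : LoopMem c.mem h (16 * ys.length + 16) Q
  records : c.out.map Prod.snd = ys.map encPoint
  search : SearchInv X ys Q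
  -- Both lengths grow by one in an iteration with output, and only the queue shrinks otherwise.
  length_lt : Q.length < ys.length
  delay_le : ∀ i < c.out.length, c.delay i ≤ D * (i + 1)
  -- An amortized bound: each pair discarded since the last output pays `D`, so the waiting time is
  -- at most `D` times the excess of outputs over pairs.
  time_le : c.time + D * Q.length ≤ c.lastTime + D * ys.length

namespace RunsOn

open BOCOInstance

variable {M : Machine} {X : BOCOInstance} {T : ℕ}

theorem height_le {y : Fin 2 → ℚ} (hy : y ∈ X.extremePts) (i : Fin 2) :
    (y i).height ≤ 2 ^ X.size := by
  obtain ⟨x, -, rfl⟩ := extremePts_subset_points hy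
  exact X.height_point_le x i

/-- The end of the run. -/
theorem exists_steps_halt_of_nil (hM : RunsOn M X T) {c : Config} {ys : List (Fin 2 → ℚ)} {h : ℕ}
    (hc : LoopInv X (T + 100) c ys [] h) :
    ∃ c', M.Steps c c' ∧ M.prog[c'.pc]? = some .halt ∧ EnumeratesExtremePoints X c' ∧
      ∀ i ≤ c'.out.length, c'.delay i ≤ (T + 100) * (i + 1) := by
  obtain ⟨pc, m, out, t⟩ := c
  obtain rfl : pc = 39 := hc.pc
  have hval : m 31 - m 30 = 0 := by
    have h30 := hc.memory.head
    have h31 := hc.memory.tail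
    rw [hc.memory.tail_eq] at h31
    simp only [List.length_nil, Nat.mul_zero, Nat.add_zero] at h30 h31
    rw [h30, h31, sub_self]
  have h1 := Machine.steps_block (M := M) (p := 39) (m := m) [.sub 20 31 30] out t
    (hM.prefix_drop ⟨_, rfl⟩) ⟨trivial, by
      simp only [Instr.value, hval]
      exact hM.fits_of_small (k := 0) (by simp [Int.Small]) (by omega), trivial⟩
  have h2 := Machine.steps_jumpZero (M := M) (p := 40) (a := 20) (q := 104)
    (execBlock [.sub 20 31 30] m) out (t + 1) (by rw [hM.prog]; rfl)
  rw [if_pos (by simpa only [execBlock, Instr.exec, Instr.target, Instr.value,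
    Function.update_self] using hval)] at h2
  refine ⟨_, h1.trans h2, by rw [hM.prog]; rfl,
    enumeratesExtremePoints_of_records hc.records hc.search.nodup hc.search.eq_extremePts, ?_⟩
  intro i hi
  have hlen : out.length = ys.length := by
    simpa using congrArg List.length hc.records
  rcases hi.lt_or_eq with hi | rfl
  · exact Eq.trans_le (Config.delay_eq_of_lt hi) (hc.delay_le i hi)
  · rw [Config.delay_length]
    have ht := hc.time_le
    simp only [Config.lastTime, List.length_nil, Nat.mul_zero] at ht ⊢
    rw [Nat.mul_add, hlen] at *
    omega

/-- The measure `2 * (2 ^ X.n - ys.length) + Q.length` falls by one in every iteration: an output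
lowers the first term by two and lengthens the queue by one, a discarded pair shortens the queue. -/
theorem exists_steps_halt_of_loopInv (hM : RunsOn M X T) (hX : X.S ≠ ∅) (N : ℕ) :
    ∀ (c : Config) (ys : List (Fin 2 → ℚ)) (Q : List ((Fin 2 → ℚ) × (Fin 2 → ℚ))) (h : ℕ),
      LoopInv X (T + 100) c ys Q h → 2 * (2 ^ X.n - ys.length) + Q.length = N →
      ∃ c', M.Steps c c' ∧ M.prog[c'.pc]? = some .halt ∧ EnumeratesExtremePoints X c' ∧
        ∀ i ≤ c'.out.length, c'.delay i ≤ (T + 100) * (i + 1) := by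
  induction N using Nat.strong_induction_on with
  | _ N ih =>
    intro c ys Q h hc hN
    rcases Q with _ | ⟨⟨u, v⟩, Q⟩
    · exact hM.exists_steps_halt_of_nil hc
    obtain ⟨pc, m, out, t⟩ := c
    obtain rfl : pc = 39 := hc.pc
    obtain ⟨hu, hv, -⟩ := hc.search.pair _ List.mem_cons_self
    have hlen : out.length = ys.length := by
      simpa using congrArg List.length hc.records
    -- Cells of the queue are never reused, yet at most `2 ^ X.n` outputs keep the addresses short.
    have he : Int.Small (X.size + 6) ((16 * ys.length + 16 : ℕ) : ℤ) := by
      have h1 := hc.search.length_le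
      have h2 : 2 ^ X.n ≤ 2 ^ X.size := Nat.pow_le_pow_right two_pos (Nat.le_add_right _ _)
      have h3 : 16 * ys.length + 16 ≤ 2 ^ (X.size + 6) := by
        rw [pow_add]
        have := Nat.one_le_two_pow (n := X.size)
        omega
      rw [Int.Small, Nat.abs_cast]
      exact_mod_cast h3
    obtain ⟨x, m', t', hx, hsteps, ht', sy, su, sv, hm'⟩ := hM.exists_steps_iteration hc.memory he
      (height_le hu) (height_le hv) hX out t
    have htime := hc.time_le
    have hlt := hc.length_lt
    simp only [List.length_cons] at htime hlt hN
    by_cases hgap : lexGap (pairWeight u v) (X.point x) u = 0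
    · rw [if_pos hgap] at hsteps
      have hinv : LoopInv X (T + 100) ⟨39, m', out, t'⟩ ys Q (h + 8) :=
        { pc := rfl
          memory := hm'
          records := hc.records
          search := hc.search.discard hx ((lexGap_eq_zero_iff _ _ _).1 hgap)
          length_lt := by omega
          delay_le := fun i hi => Eq.trans_le (Config.delay_eq_of_lt hi) (hc.delay_le i hi)
          time_le := by
            simp only [Config.lastTime] at htime ⊢
            rw [Nat.mul_add] at htime
            omega }
      obtain ⟨c', hs, hc'⟩ := ih _ (by omega) _ _ _ _ hinv rfl
      exact ⟨c', hsteps.trans hs, hc'⟩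
    · rw [if_neg hgap] at hsteps
      have hsearch := hc.search.extend hx fun h => hgap ((lexGap_eq_zero_iff _ _ _).2 h)
      obtain ⟨m'', hsteps', hm''⟩ := hM.exists_steps_append hm' he (X.height_point_le x)
        (height_le hu) (height_le hv) sy su sv out t'
      have hinv : LoopInv X (T + 100)
          ⟨39, m'', out ++ [(t' + 5, encPoint (X.point x))], t' + 23⟩ (ys ++ [X.point x])
          (Q ++ [(X.point x, u), (X.point x, v)]) (h + 8) :=
        { pc := rfl
          memory := by
            simpa only [List.length_append, List.length_singleton, Nat.mul_add, Nat.mul_one,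
              Nat.add_right_comm] using hm''
          records := by
            simpa using hc.records
          search := hsearch
          length_lt := by
            simp only [List.length_append, List.length_cons, List.length_nil]
            omega
          delay_le := by
            intro i hi
            simp only [List.length_append, List.length_singleton] at hi
            rcases (Nat.lt_succ_iff.1 hi).lt_or_eq with hi | rfl
            · rw [Config.delay_of_out_append (c := ⟨39, m, out, t⟩) rfl hi]
              exact hc.delay_le i hi
            · have := Config.delay_length_of_out_append (c := ⟨39, m, out, t⟩)
                (d := ⟨39, m'', out ++ [(t' + 5, encPoint (X.point x))], t' + 23⟩) rfl
              simp only at this htime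
              rw [this, hlen, Nat.mul_add]
              rw [Nat.mul_add] at htime
              omega
          time_le := by
            rw [Config.lastTime_of_out_append (c := ⟨39, m, out, t⟩) rfl]
            simp only [List.length_append, List.length_cons, List.length_nil, Nat.zero_add,
              Nat.reduceAdd]
            -- The strict inequality `length_lt` leaves one spare `T + 100`, which pays for the 18
            -- steps from the output back to the loop head.
            have : (T + 100) * (Q.length + 2) + (T + 100) ≤ (T + 100) * (ys.length + 1) := by
              rw [← Nat.mul_succ]
              exact Nat.mul_le_mul_left _ (by omega)
            omega }
      have hle := hsearch.length_le
      simp only [List.length_append, List.length_singleton] at hle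
      obtain ⟨c', hs, hc'⟩ := ih _ (by
        simp only [List.length_append, List.length_cons, List.length_nil]
        omega) _ _ _ _ hinv rfl
      exact ⟨c', (hsteps.trans hsteps').trans hs, hc'⟩

/-! ### The initial step and the complete run -/

/-- The comparison of the first two points. -/
def equalityBlock : List Instr := [
  .sub 20 5 10, .sub 21 6 11, .sub 22 7 12, .sub 23 8 13,
  .mul 20 20 20, .mul 21 21 21, .mul 22 22 22, .mul 23 23 23,
  .add 20 20 21, .add 20 20 22, .add 20 20 23]

/-- The instructions that initialize the queue. -/
def queueInitBlock : List Instr := [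
  .copy 40 10, .copy 41 11, .copy 42 12, .copy 43 13,
  .copy 44 5, .copy 45 6, .copy 46 7, .copy 47 8,
  .const 30 40, .const 31 48, .const 32 8, .const 33 16]

theorem eq_zero_of_sum_four_mul_self {a b c d : ℤ} (h : a * a + b * b + c * c + d * d = 0) :
    a = 0 ∧ b = 0 ∧ c = 0 ∧ d = 0 := by
  have ha := mul_self_nonneg a
  have hb := mul_self_nonneg b
  have hc := mul_self_nonneg c
  have hd := mul_self_nonneg d
  exact ⟨mul_self_eq_zero.1 (by linarith), mul_self_eq_zero.1 (by linarith),
    mul_self_eq_zero.1 (by linarith), mul_self_eq_zero.1 (by linarith)⟩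

/-- Fractions in lowest terms with positive denominator are unique, so the points are equal exactly
if the sum of the four squared differences vanishes. -/
theorem exists_steps_equality (hM : RunsOn M X T) {m : ℕ → ℤ} {y z : Fin 2 → ℚ}
    (hy : ∀ i, (y i).height ≤ 2 ^ X.size) (hz : ∀ i, (z i).height ≤ 2 ^ X.size)
    (hmy : StoredAt m 10 (encPoint y)) (hmz : StoredAt m 5 (encPoint z))
    (out : List (ℕ × List ℤ)) (t : ℕ) :
    ∃ m', M.Steps ⟨14, m, out, t⟩ ⟨if y = z then 104 else 26, m', out, t + 12⟩ ∧
      ∀ a, (a < 20 ∨ 23 < a) → m' a = m a := by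
  obtain ⟨hy0, hy1, hy2, hy3⟩ := storedAt_encPoint.1 hmy
  obtain ⟨hz0, hz1, hz2, hz3⟩ := storedAt_encPoint.1 hmz
  have d0 := (Rat.small_num (hz 0)).sub (Rat.small_num (hy 0))
  have d1 := (Rat.small_den (hz 0)).sub (Rat.small_den (hy 0))
  have d2 := (Rat.small_num (hz 1)).sub (Rat.small_num (hy 1))
  have d3 := (Rat.small_den (hz 1)).sub (Rat.small_den (hy 1))
  have s1 := (d0.mul d0).add (d1.mul d1)
  have s2 := s1.add ((d2.mul d2).mono (Nat.le_add_right _ 1))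
  have s3 := s2.add ((d3.mul d3).mono (Nat.le_add_right _ 2))
  have fit := fun {k : ℕ} {z : ℤ} => hM.fits_of_small (k := k) (z := z)
  have h1 := Machine.steps_block (M := M) (p := 14) (m := m) equalityBlock out t
    (hM.prefix_drop ⟨_, rfl⟩) (by
      simp only [equalityBlock, BlockFits, Instr.Regular, Instr.value, Instr.target, Instr.exec,
        Function.update_apply, hy0, hy1, hy2, hy3, hz0, hz1, hz2, hz3, Nat.reduceEqDiff,
        if_true, if_false, true_and, and_true]
      exact ⟨fit d0 (by omega), fit d1 (by omega), fit d2 (by omega), fit d3 (by omega),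
        fit (d0.mul d0) (by omega), fit (d1.mul d1) (by omega), fit (d2.mul d2) (by omega),
        fit (d3.mul d3) (by omega), fit s1 (by omega), fit s2 (by omega), fit s3 (by omega)⟩)
  have h2 := Machine.steps_jumpZero (M := M) (p := 25) (a := 20) (q := 104)
    (execBlock equalityBlock m) out (t + 11) (by rw [hM.prog]; rfl)
  have hval : execBlock equalityBlock m 20 = ((z 0).num - (y 0).num) * ((z 0).num - (y 0).num) +
      ((z 0).den - (y 0).den) * ((z 0).den - (y 0).den) +
      ((z 1).num - (y 1).num) * ((z 1).num - (y 1).num) +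
      ((z 1).den - (y 1).den) * ((z 1).den - (y 1).den) := by
    rw [← hy0, ← hy1, ← hy2, ← hy3, ← hz0, ← hz1, ← hz2, ← hz3]
    rfl
  have hiff : execBlock equalityBlock m 20 = 0 ↔ y = z := by
    rw [hval]
    constructor
    · intro h
      obtain ⟨e0, e1, e2, e3⟩ := eq_zero_of_sum_four_mul_self h
      rw [sub_eq_zero] at e0 e1 e2 e3
      funext i
      fin_cases i
      · exact Rat.ext e0.symm (by exact_mod_cast e1.symm)
      · exact Rat.ext e2.symm (by exact_mod_cast e3.symm)
    · rintro rfl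
      simp
  simp only [hiff] at h2
  refine ⟨_, h1.trans h2, ?_⟩
  intro a ha
  have hd : ∀ d, 20 ≤ d → d ≤ 23 → a ≠ d := fun d _ _ => by omega
  simp [equalityBlock, execBlock, Instr.target, Instr.exec, hd]

/-- The first call of the subroutine starts after four steps. -/
theorem exists_steps_init (hM : RunsOn M X T) : ∃ m,
    M.Steps (Config.init []) ⟨4, m, [], 4⟩ ∧ m 0 = 1 ∧ m 1 = 1 ∧ m 2 = 0 ∧ m 3 = 1 :=
  ⟨_, Machine.steps_block (M := M) (p := 0) (m := (Config.init []).mem)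
    [.const 0 1, .const 1 1, .const 2 0, .const 3 1] [] 0 (hM.prefix_drop ⟨_, rfl⟩) (by
      have h0 : (encInt 0 : ℕ∞) ≤ M.wordSize :=
        hM.fits_of_small (k := 0) (by simp [Int.Small]) (by omega)
      have h1 : (encInt 1 : ℕ∞) ≤ M.wordSize :=
        hM.fits_of_small (k := 0) (by simp [Int.Small]) (by omega)
      exact ⟨trivial, h1, trivial, h1, trivial, h0, trivial, h1, trivial⟩), rfl, rfl, rfl, rfl⟩

theorem exists_haltsIn_of_empty (hM : RunsOn M X T) (hX : X.S = ∅) :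
    ∃ c, M.HaltsIn [] c ∧ EnumeratesExtremePoints X c ∧
      ∀ i ≤ c.out.length, c.delay i ≤ (T + 100) * (i + 1) := by
  obtain ⟨m, s1, h0, h1, h2, h3⟩ := hM.exists_steps_init
  obtain ⟨ans, t, hans, ht, hlex⟩ := hM.sub ![1, 0] (by intro i; fin_cases i <;> simp)
    (by intro i; fin_cases i <;> simp [Int.Small, one_le_pow₀])
  obtain rfl : ans = [] := by
    rcases hlex with ⟨-, h⟩ | ⟨x, hx, -⟩
    · exact h
    · simpa [hX] using hx.1
  have s2 := Machine.steps_call (M := M) (p := 4) (as := [0, 1, 2, 3]) (d := 4) (m := m) [] 4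
    (by rw [hM.prog]; rfl) (by simpa [h0, h1, h2, h3] using hans)
    (hM.fits_of_small (k := 0) (by simp [Int.Small]) (by omega)) (by simp)
  have s3 := Machine.steps_jumpZero (M := M) (p := 5) (a := 4) (q := 104)
    (receive m 4 []) [] (4 + 1 + 4 + t + 0) (by rw [hM.prog]; rfl)
  rw [if_pos (show receive m 4 [] 4 = 0 from rfl)] at s3
  refine ⟨_, ⟨(s1.trans s2).trans s3, ?_⟩, enumeratesExtremePoints_of_records (ys := []) rfl
    List.nodup_nil ?_, ?_⟩
  · rw [hM.prog]
    rfl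
  · ext y
    simp only [List.not_mem_nil]
    refine ⟨False.elim, fun hy => ?_⟩
    obtain ⟨x, hx, -⟩ := extremePts_subset_points hy
    simp [hX] at hx
  · intro i hi
    obtain rfl : i = 0 := by simpa using hi
    simp [Config.delay]
    omega

theorem exists_haltsIn (hM : RunsOn M X T) :
    ∃ c, M.HaltsIn [] c ∧ EnumeratesExtremePoints X c ∧
      ∀ i ≤ c.out.length, c.delay i ≤ (T + 100) * (i + 1) := by
  by_cases hX : X.S = ∅
  · exact hM.exists_haltsIn_of_empty hX
  obtain ⟨m, s1, h0, h1, h2, h3⟩ := hM.exists_steps_init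
  have fit0 : (encInt 0 : ℕ∞) ≤ M.wordSize :=
    hM.fits_of_small (k := 0) (by simp [Int.Small]) (by omega)
  have fit1 : (encInt 1 : ℕ∞) ≤ M.wordSize :=
    hM.fits_of_small (k := 0) (by simp [Int.Small]) (by omega)
  obtain ⟨x, m1, t1, hx, s2, ht1, y1, four, e1⟩ := hM.exists_steps_call (p := 4) [] 4
    (by rw [hM.prog]; rfl) (l := ![1, 0]) (by intro i; fin_cases i <;> simp)
    (by intro i; fin_cases i <;> simp [Int.Small, one_le_pow₀]) h0 h1 h2 h3 hX
  have s3 := Machine.steps_jumpZero (M := M) (p := 5) (a := 4) (q := 104) m1 [] t1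
    (by rw [hM.prog]; rfl)
  rw [if_neg (by rw [four]; decide)] at s3
  have s4 := Machine.steps_emit (M := M) (p := 6) (as := [5, 6, 7, 8]) m1 [] (t1 + 1)
    (by rw [hM.prog]; rfl)
  obtain ⟨y10, y11, y12, y13⟩ := storedAt_encPoint.1 y1
  have hrec : [5, 6, 7, 8].map m1 = encPoint (X.point x) := by
    simp [encPoint, y10, y11, y12, y13]
  rw [hrec] at s4
  have hcells := hM.fits_encPoint (X.height_point_le x)
  simp only [encPoint, List.mem_cons, List.not_mem_nil, or_false, forall_eq_or_imp,
    forall_eq] at hcells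
  obtain ⟨c0, c1, c2, c3⟩ := hcells
  have s5 := Machine.steps_block (M := M) (p := 7) (m := m1)
    [.copy 10 5, .copy 11 6, .copy 12 7, .copy 13 8, .const 0 0, .const 2 1]
    [(t1 + 6, encPoint (X.point x))] (t1 + 6) (hM.prefix_drop ⟨_, rfl⟩) (by
      refine ⟨trivial, ?_, trivial, ?_, trivial, ?_, trivial, ?_, trivial, fit0, trivial, fit1,
        trivial⟩
      · rw [← y10] at c0; exact c0
      · rw [← y11] at c1; exact c1
      · rw [← y12] at c2; exact c2
      · rw [← y13] at c3; exact c3)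
  set m2 := execBlock
    [.copy 10 5, .copy 11 6, .copy 12 7, .copy 13 8, .const 0 0, .const 2 1] m1 with hm2
  have y2 : StoredAt m2 10 (encPoint (X.point x)) := storedAt_encPoint.2 ⟨y10, y11, y12, y13⟩
  have one2 : m2 1 = 1 := (e1 1 (by decide)).trans h1
  have three2 : m2 3 = 1 := (e1 3 (by decide)).trans h3
  obtain ⟨z, m3, t3, hz, s6, ht3, z3, -, e3⟩ := hM.exists_steps_call (p := 13) (m := m2)
    [(t1 + 6, encPoint (X.point x))] (t1 + 12) (by rw [hM.prog]; rfl) (l := ![0, 1])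
    (by intro i; fin_cases i <;> simp)
    (by intro i; fin_cases i <;> simp [Int.Small, one_le_pow₀]) rfl one2 rfl three2 hX
  have y3 : StoredAt m3 10 (encPoint (X.point x)) := y2.congr fun b hb _ => e3 b (by omega)
  obtain ⟨m4, s7, e4⟩ := hM.exists_steps_equality (X.height_point_le x) (X.height_point_le z) y3 z3
    [(t1 + 6, encPoint (X.point x))] t3
  have hxE : X.point x ∈ X.extremePts := hx.mem_extremePts
    (by intro i; fin_cases i <;> simp)
  have hzE : X.point z ∈ X.extremePts := hz.mem_extremePts
    (by intro i; fin_cases i <;> simp)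
  have hx0 : ∀ e ∈ X.extremePts, X.point x 0 ≤ e 0 := fun e he => by
    simpa [dotProduct, Fin.sum_univ_two] using hx.dotProduct_le (extremePts_subset_points he)
  have hz1 : ∀ e ∈ X.extremePts, X.point z 1 ≤ e 1 := fun e he => by
    simpa [dotProduct, Fin.sum_univ_two] using hz.dotProduct_le (extremePts_subset_points he)
  have s := (((((s1.trans s2).trans s3).trans s4).trans s5).trans s6).trans s7
  by_cases hxz : X.point x = X.point z
  · rw [if_pos hxz] at s
    refine ⟨_, ⟨s, by rw [hM.prog]; rfl⟩,
      enumeratesExtremePoints_of_records (ys := [X.point x]) rfl (List.nodup_singleton _) ?_, ?_⟩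
    · ext e
      simp only [List.mem_singleton]
      constructor
      · rintro rfl
        exact hxE
      · intro he
        -- The common point minimizes both components at once, so it dominates every extreme point.
        exact (eq_of_le_of_mem_extremePts he (extremePts_subset_points hxE) (hx0 e he)
          (hxz ▸ hz1 e he)).symm
    · intro i hi
      have : i = 0 ∨ i = 1 := by
        have : i ≤ 1 := hi
        omega
      rcases this with rfl | rfl
      · simp [Config.delay]
        omega
      · simp [Config.delay]
        omega
  · rw [if_neg hxz] at s
    have s8 := Machine.steps_emit (M := M) (p := 26) (as := [5, 6, 7, 8]) m4
      [(t1 + 6, encPoint (X.point x))] (t3 + 12) (by rw [hM.prog]; rfl)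
    have z4 : StoredAt m4 5 (encPoint (X.point z)) := z3.congr fun b hb hb' => by
      simp only [encPoint, List.length_cons, List.length_nil] at hb'
      exact e4 b (by omega)
    have y4 : StoredAt m4 10 (encPoint (X.point x)) := y3.congr fun b hb hb' => by
      simp only [encPoint, List.length_cons, List.length_nil] at hb'
      exact e4 b (by omega)
    obtain ⟨z40, z41, z42, z43⟩ := storedAt_encPoint.1 z4
    obtain ⟨y40, y41, y42, y43⟩ := storedAt_encPoint.1 y4
    have hrec' : [5, 6, 7, 8].map m4 = encPoint (X.point z) := by
      simp [encPoint, z40, z41, z42, z43]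
    rw [hrec'] at s8
    have hcells := hM.fits_encPoint (X.height_point_le z)
    simp only [encPoint, List.mem_cons, List.not_mem_nil, or_false, forall_eq_or_imp,
      forall_eq] at hcells
    obtain ⟨d0, d1, d2, d3⟩ := hcells
    have small : ∀ z : ℤ, |z| ≤ 2 ^ 6 → (encInt z : ℕ∞) ≤ M.wordSize := fun z hz =>
      hM.fits_of_small (k := 6) hz (by omega)
    have s9 := Machine.steps_block (M := M) (p := 27) (m := m4) queueInitBlock
      [(t1 + 6, encPoint (X.point x)), (t3 + 17, encPoint (X.point z))] (t3 + 17)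
      (hM.prefix_drop ⟨_, rfl⟩) (by
        rw [← y40] at c0
        rw [← y41] at c1
        rw [← y42] at c2
        rw [← y43] at c3
        rw [← z40] at d0
        rw [← z41] at d1
        rw [← z42] at d2
        rw [← z43] at d3
        exact ⟨trivial, c0, trivial, c1, trivial, c2, trivial, c3, trivial, d0, trivial, d1,
          trivial, d2, trivial, d3, trivial, small 40 (by norm_num), trivial,
          small 48 (by norm_num), trivial, small 8 (by norm_num), trivial,
          small 16 (by norm_num), trivial⟩)
    have hinv : LoopInv X (T + 100) ⟨39, execBlock queueInitBlock m4,
        [(t1 + 6, encPoint (X.point x)), (t3 + 17, encPoint (X.point z))], t3 + 29⟩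
        [X.point x, X.point z] [(X.point x, X.point z)] 40 :=
      { pc := rfl
        memory :=
          { one := (e4 1 (by decide)).trans ((e3 1 (by decide)).trans one2)
            three := (e4 3 (by decide)).trans ((e3 3 (by decide)).trans three2)
            head := rfl
            tail := rfl
            eight := rfl
            sixteen := rfl
            le_head := le_rfl
            tail_eq := rfl
            stored := ⟨y40, y41, y42, y43, z40, z41, z42, z43, trivial⟩ }
        records := rfl
        search := SearchInv.start hxE hzE hxz hx0 hz1
        length_lt := by simp
        delay_le := by
          intro i hi
          have : i = 0 ∨ i = 1 := by
            have : i < 2 := hi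
            omega
          rcases this with rfl | rfl
          · simp [Config.delay]
            omega
          · simp [Config.delay]
            omega
        time_le := by
          simp [Config.lastTime]
          omega }
    obtain ⟨c, hs, hc, hc'⟩ := hM.exists_steps_halt_of_loopInv hX _ _ _ _ _ hinv rfl
    exact ⟨c, ⟨((s.trans s8).trans s9).trans hs, hc⟩, hc'⟩

end RunsOn

/-! ## The two statements -/

theorem encPoint_intCast (l : Fin 2 → ℤ) :
    encPoint (fun i => (l i : ℚ)) = [l 0, 1, l 1, 1] := by
  simp [encPoint]

theorem encVec_intCast_le {l : Fin 2 → ℤ} {k : ℕ} (h : ∀ i, Int.Small k (l i)) :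
    encVec (fun i => (l i : ℚ)) ≤ 2 * k + 10 := by
  have h1 : encInt 1 ≤ 2 := encInt_le_of_natAbs_le (k := 0) (by simp)
  have h2 := fun i => (h i).encInt_le
  have h3 := h2 0
  have h4 := h2 1
  simp only [encVec, encRat, Fin.sum_univ_two, Rat.num_intCast, Rat.den_intCast, Nat.cast_one]
  omega

theorem Polynomial.eval_nat_mono (p : Polynomial ℕ) {a b : ℕ} (h : a ≤ b) :
    p.eval a ≤ p.eval b := by
  rw [Polynomial.eval_eq_sum_range, Polynomial.eval_eq_sum_range]
  exact Finset.sum_le_sum fun i _ => Nat.mul_le_mul_left _ (Nat.pow_le_pow_left h i)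

/-- No time bound is given for the oracle, but the weights that a run can ask for are integer
vectors in a finite box, and the maximum over the box serves as `T`. -/
theorem exists_runsOn_of_isLexOracle {X : BOCOInstance} {oracle : Subroutine} (w : List Bool)
    (h : IsLexOracle X oracle) :
    ∃ T, RunsOn { prog := dichotomicApproach, wordSize := ⊤, input := w, sub := oracle } X T := by
  -- The time is quantified before the sign condition so that `choose` yields a total function; `0`
  -- is a dummy value.
  have h' : ∀ l : Fin 2 → ℤ, ∃ t, 0 ≤ l → ∃ ans, oracle [l 0, 1, l 1, 1] = some (ans, t) ∧
      IsLexAnswer X (fun i => (l i : ℚ)) ans := by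
    intro l
    by_cases hl : 0 ≤ l
    · obtain ⟨ans, t, h1, h2⟩ := h (fun i => (l i : ℚ)) fun i => Int.cast_nonneg (hl i)
      rw [encPoint_intCast] at h1
      exact ⟨t, fun _ => ⟨ans, h1, h2⟩⟩
    · exact ⟨0, fun h => absurd h hl⟩
  choose time htime using h'
  obtain ⟨T, hT⟩ := ((Set.finite_Icc (0 : Fin 2 → ℤ)
    (fun _ => 2 ^ (4 * X.size + 1))).image time).bddAbove
  refine ⟨T, rfl, fun _ _ => le_top, fun l hl hs => ?_⟩
  obtain ⟨ans, h1, h2⟩ := htime l hl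
  exact ⟨ans, time l, h1, hT ⟨l, ⟨hl, fun i => (le_abs_self _).trans (hs i)⟩, rfl⟩, h2⟩

/-- Weights with exponent `4s + 1`, where `s` is the size, have encoding length at most `2 * (4s +
1) + 10`; adding `s` gives the argument `9s + 12`. The second condition on `W` is the exponent `8s +
10` plus the two extra bits of `encInt`. -/
theorem runsOn_programSubroutine {P : BOCOProblem} {A : List Instr} {p : Polynomial ℕ}
    (hp : ∀ w ∈ P.I, ∀ l : Fin 2 → ℚ, 0 ≤ l → ∃ c : Config,
      (plainMachine A (p.eval ((P.inst w).size + encVec l) : ℕ) w).HaltsIn (encPoint l) c ∧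
      c.time ≤ p.eval ((P.inst w).size + encVec l) ∧ IsLexAnswer (P.inst w) l c.answer)
    {w : List Bool} (hw : w ∈ P.I) {W : ℕ} (hW1 : p.eval (9 * (P.inst w).size + 12) ≤ W)
    (hW2 : 8 * (P.inst w).size + 12 ≤ W) :
    RunsOn { prog := dichotomicApproach, wordSize := W, input := w,
             sub := programSubroutine A W w } (P.inst w)
      (p.eval (9 * (P.inst w).size + 12)) := by
  refine ⟨rfl, fun z hz => ?_, fun l hl hs => ?_⟩
  · exact Nat.cast_le.2 (hz.encInt_le.trans hW2)
  · obtain ⟨c, h1, h2, h3⟩ := hp w hw (fun i => (l i : ℚ)) fun i => Int.cast_nonneg (hl i)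
    have hle : p.eval ((P.inst w).size + encVec fun i => (l i : ℚ)) ≤
        p.eval (9 * (P.inst w).size + 12) := by
      have := encVec_intCast_le hs
      exact p.eval_nat_mono (by omega)
    rw [encPoint_intCast] at h1
    exact ⟨c.answer, c.time, programSubroutine_eq (by exact_mod_cast hle.trans hW1) h1,
      h2.trans hle, h3⟩

theorem mainTheorem7 (P : BOCOProblem) :
    (∀ w ∈ P.I, ∀ oracle : Subroutine, IsLexOracle (P.inst w) oracle →
      ∃ c : Config,
        ({ prog := dichotomicApproach, wordSize := ⊤, input := w, sub := oracle } :
          Machine).HaltsIn [] c ∧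
        EnumeratesExtremePoints (P.inst w) c) ∧
    (∀ A : List Instr, SolvesLexInPolyTime P A →
      ∃ q : Polynomial ℕ, ∀ w ∈ P.I, ∃ c : Config,
        ({ prog := dichotomicApproach
           wordSize := (q.eval (P.inst w).size : ℕ)
           input := w
           sub := programSubroutine A (q.eval (P.inst w).size : ℕ) w } : Machine).HaltsIn [] c ∧
        EnumeratesExtremePoints (P.inst w) c ∧
        ∀ i ≤ c.out.length, c.delay i ≤ q.eval ((P.inst w).size + i)) := by
  constructor
  · intro w _ oracle horacle
    obtain ⟨T, hM⟩ := exists_runsOn_of_isLexOracle w horacle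
    obtain ⟨c, h1, h2, -⟩ := hM.exists_haltsIn
    exact ⟨c, h1, h2⟩
  · rintro A ⟨p, hp⟩
    let r : Polynomial ℕ := p.comp (Polynomial.C 9 * Polynomial.X + Polynomial.C 12)
    -- The first summand covers the delays and the word size of the subroutine, the second the cells
    -- of the main program.
    let q : Polynomial ℕ := (r + Polynomial.C 100) * (Polynomial.X + Polynomial.C 1) +
      (Polynomial.C 8 * Polynomial.X + Polynomial.C 12)
    have hq : ∀ s, q.eval s = (p.eval (9 * s + 12) + 100) * (s + 1) + (8 * s + 12) := by
      intro s
      simp only [q, r, Polynomial.eval_add, Polynomial.eval_mul, Polynomial.eval_comp,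
        Polynomial.eval_C, Polynomial.eval_X]
    refine ⟨q, fun w hw => ?_⟩
    have hM := runsOn_programSubroutine hp hw (W := q.eval (P.inst w).size)
      (by rw [hq, Nat.mul_succ]; omega) (by rw [hq]; omega)
    obtain ⟨c, h1, h2, h3⟩ := hM.exists_haltsIn
    refine ⟨c, h1, h2, fun i hi => (h3 i hi).trans ?_⟩
    rw [hq]
    -- In the bound `(T + 100) * (i + 1)`, both factors are monotonically enlarged to the argument
    -- `size + i`.
    have hle : p.eval (9 * (P.inst w).size + 12) ≤ p.eval (9 * ((P.inst w).size + i) + 12) :=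
      p.eval_nat_mono (by omega)
    exact (Nat.mul_le_mul (by omega) (by omega)).trans (Nat.le_add_right _ _)
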